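/- Let $d,n,k\in\mathbb N$, let $\Omega\subset\mathbb R^d$ be the closure of a bounded open convex set and $Q=[0,1]\times\Omega$. Let $\mathbb S^n,\mathbb S^n_+,\mathbb S^n_{++}$ denote the symmetric, positive semidefinite and positive definite real $n\times n$ matrices, $\mathbb M^n=\mathbb R^{n\times n}$, and $A\cdot B=\operatorname{tr}(A^{\rm T}B)$. For $V\subset\mathbb R^{n\times m}$ let $\mathcal M(\mathcal X,V)$ be the set of $V$-valued Radon measures on a compact metric space $\mathcal X$. Let $\Lambda=(\Lambda_1,\Lambda_2)$ with $\Lambda_1\in\mathbb S^k_+$, $\Lambda_2\in\mathbb S^n_{++}$, and let $\mathsf D^*=\mathsf D^*_0+\sum_{l=1}^d \mathsf D^*_l\,\partial_{x_l}$, with linear maps $\mathsf D^*_l:\mathbb S^n\to\mathbb R^{n\times k}$ ($0\le l\le d$), be a first-order constant-coefficient linear differential operator with $\mathsf D^*(I)=0$. Put $$\mathcal O_\Lambda=\{(A,B,C)\in\mathbb S^n\times\mathbb R^{n\times k}\times\mathbb M^n:\ A+\tfrac12B\Lambda_1^2B^{\rm T}+\tfrac12C\Lambda_2^2C^{\rm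 T}\preceq0\},$$ $$J_\Lambda(X,Y,Z)=\sup_{(A,B,C)\in\mathcal O_\Lambda}\big(X\cdot A+Y\cdot B+Z\cdot C\big)\in[0,\infty],$$ and, for $\mu=(\mathsf G,\mathsf q,\mathsf R)\in\mathcal M(Q,\mathbb S^n)\times\mathcal M(Q,\mathbb R^{n\times k})\times\mathcal M(Q,\mathbb M^n)$, $$\mathcal J_{\Lambda,Q}(\mu)=\int_Q J_\Lambda\Big(\frac{{\rm d}\mu}{{\rm d}\lambda}\Big)\,{\rm d}\lambda,$$ where $\lambda$ is any finite positive measure with $|\mu|\ll\lambda$ (the value does not depend on $\lambda$). For $\mathsf G_0,\mathsf G_1\in\mathcal M(\Omega,\mathbb S^n_+)$ let $\mathcal{CE}(\mathsf G_0,\mathsf G_1)$ be the set of all such $\mu$ with $$\int_Q\partial_t\Phi\cdot{\rm d}\mathsf G+\mathsf D^*\Phi\cdot{\rm d}\mathsf q+\Phi\cdot{\rm d}\mathsf R=\int_\Omega\Phi(1,\cdot)\cdot{\rm d}\mathsf G_1-\int_\Omega\Phi(0,\cdot)\cdot{\rm d}\mathsf G_0\qquad\forall\,\Phi\in C^1(Q,\mathbb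 S^n)$$ ($\mathsf D^*$ acting on the space variable), and let $${\rm WB}_\Lambda^2(\mathsf G_0,\mathsf G_1)=\inf_{\mu\in\mathcal{CE}(\mathsf G_0,\mathsf G_1)}\mathcal J_{\Lambda,Q}(\mu)\in[0,\infty],\qquad {\rm WB}_\Lambda=\sqrt{{\rm WB}_\Lambda^2}.$$ Then ${\rm WB}_\Lambda^2$ is sublinear on $\mathcal M(\Omega,\mathbb S^n_+)\times\mathcal M(\Omega,\mathbb S^n_+)$: for all $\alpha>0$ and $\mathsf G_0,\mathsf G_1,\widetilde{\mathsf G}_0,\widetilde{\mathsf G}_1\in\mathcal M(\Omega,\mathbb S^n_+)$, $${\rm WB}^2_\Lambda(\alpha\mathsf G_0,\alpha\mathsf G_1)=\alpha\,{\rm WB}^2_\Lambda(\mathsf G_0,\mathsf G_1),\qquad {\rm WB}^2_\Lambda(\mathsf G_0+\widetilde{\mathsf G}_0,\mathsf G_1+\widetilde{\mathsf G}_1)\le{\rm WB}^2_\Lambda(\mathsf G_0,\mathsf G_1)+{\rm WB}^2_\Lambda(\widetilde{\mathsf G}_0,\widetilde{\mathsf G}_1).$$ Moreover, ${\rm WB}_\Lambda$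 is jointly lower semicontinuous for the weak-star topology: whenever $\mathsf G^i_0$ and $\mathsf G^i_1$ in $\mathcal M(\Omega,\mathbb S^n_+)$ converge weak-star, along a filter on the index set, to $\mathsf G_0$ and $\mathsf G_1$ in $\mathcal M(\Omega,\mathbb S^n_+)$ (in particular, for weak-star convergent sequences, as $i\to\infty$), then $${\rm WB}_\Lambda(\mathsf G_0,\mathsf G_1)\le\liminf_{i}\,{\rm WB}_\Lambda(\mathsf G^i_0,\mathsf G^i_1).$$ -/

import Mathlib

open MeasureTheory Filter Topology
open scoped ENNReal Matrix

noncomputable section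

namespace WassersteinBures

/-- Finite `ℝ^{m × n}`-valued Borel measures, identified (by vectorization) with matrices of finite
signed measures. On a compact metric space these are the matrix-valued Radon measures. -/
abbrev MatrixMeasure (X : Type*) [MeasurableSpace X] (m n : ℕ) : Type _ :=
  Matrix (Fin m) (Fin n) (SignedMeasure X)

section General

variable {X : Type*} [MeasurableSpace X]

/-- The matrix `G(E)`. -/
def MatrixMeasure.eval {m n : ℕ} (G : MatrixMeasure X m n) (E : Set X) :
    Matrix (Fin m) (Fin n) ℝ :=
  Matrix.of fun i j => G i j E

/-- `G` takes values in the symmetric positive semidefinite matrices. -/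
def MatrixMeasure.IsPSD {n : ℕ} (G : MatrixMeasure X n n) : Prop :=
  ∀ E : Set X, MeasurableSet E → (G.eval E).PosSemidef

/-- The duality pairing `⟨G, Φ⟩ = ∫ Φ · dG = ∑ i j, ∫ Φ_{ij} dG_{ij}`. -/
def pairing {m n : ℕ} (G : MatrixMeasure X m n) (Φ : X → Matrix (Fin m) (Fin n) ℝ) : ℝ :=
  ∑ i, ∑ j, ∫ᵛ x, Φ x i j ∂<•(G i j)

/-- Weak-star convergence `H i → G` along the filter `l`:
`⟨H i, φ⟩ → ⟨G, φ⟩` for every continuous matrix field `φ`. -/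
def WeakStarTendsto [TopologicalSpace X] {m n : ℕ} {ι : Type*} (H : ι → MatrixMeasure X m n)
    (l : Filter ι) (G : MatrixMeasure X m n) : Prop :=
  ∀ φ : C(X, Matrix (Fin m) (Fin n) ℝ), Tendsto (fun i => pairing (H i) φ) l (𝓝 (pairing G φ))

/-- The density `dG/dλ` of `G` with respect to a positive measure. -/
def density {m n : ℕ} (G : MatrixMeasure X m n) (lam : Measure X) (x : X) :
    Matrix (Fin m) (Fin n) ℝ :=
  Matrix.of fun i j => (G i j).rnDeriv lam x

/-- The sum of the total variations of the entries of `G`; it is equivalent to `|G|`. -/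
def entryVariation {m n : ℕ} (G : MatrixMeasure X m n) : Measure X :=
  ∑ i, ∑ j, (G i j).totalVariation

end General

/-- The Frobenius inner product `A · B = tr(Aᵀ B)`. -/
def frob {m n : ℕ} (A B : Matrix (Fin m) (Fin n) ℝ) : ℝ := (Aᵀ * B).trace

/-- The closed convex set `O_Λ` of all `(A, B, C) ∈ 𝕊ⁿ × ℝ^{n × k} × ℝ^{n × n}` with
`A + ½ B Λ₁² Bᵀ + ½ C Λ₂² Cᵀ ⪯ 0`. -/
def setO {n k : ℕ} (Λ₁ : Matrix (Fin k) (Fin k) ℝ) (Λ₂ : Matrix (Fin n) (Fin n) ℝ) :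
    Set (Matrix (Fin n) (Fin n) ℝ × Matrix (Fin n) (Fin k) ℝ × Matrix (Fin n) (Fin n) ℝ) :=
  {p | p.1.IsSymm ∧
    (-(p.1 + (1 / 2 : ℝ) • (p.2.1 * Λ₁ ^ 2 * p.2.1ᵀ)
      + (1 / 2 : ℝ) • (p.2.2 * Λ₂ ^ 2 * p.2.2ᵀ))).PosSemidef}

/-- The support function `J_Λ(X, Y, Z) = sup_{(A, B, C) ∈ O_Λ} (X · A + Y · B + Z · C)`, with values
in `[0, ∞]`: as `0 ∈ O_Λ`, the supremum does not change when negative values are replaced by `0`. -/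
def costJ {n k : ℕ} (Λ₁ : Matrix (Fin k) (Fin k) ℝ) (Λ₂ : Matrix (Fin n) (Fin n) ℝ)
    (X : Matrix (Fin n) (Fin n) ℝ) (Y : Matrix (Fin n) (Fin k) ℝ) (Z : Matrix (Fin n) (Fin n) ℝ) :
    ℝ≥0∞ :=
  ⨆ p ∈ setO Λ₁ Λ₂, ENNReal.ofReal (frob X p.1 + frob Y p.2.1 + frob Z p.2.2)

/-- The action `∫ J_Λ(dμ/dλ) dλ` of `μ = (G, q, R)`. The reference measure `λ` is the sum of the
total variations of all entries; by homogeneity of `J_Λ` every finite `λ ≫ |μ|` gives the same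
value. -/
def action {X : Type*} [MeasurableSpace X] {n k : ℕ}
    (Λ₁ : Matrix (Fin k) (Fin k) ℝ) (Λ₂ : Matrix (Fin n) (Fin n) ℝ)
    (G : MatrixMeasure X n n) (q : MatrixMeasure X n k) (R : MatrixMeasure X n n) : ℝ≥0∞ :=
  let lam : Measure X := entryVariation G + entryVariation q + entryVariation R
  ∫⁻ x, costJ Λ₁ Λ₂ (density G lam x) (density q lam x) (density R lam x) ∂lam

/-- The coefficients of a first-order constant-coefficient linear differential operator on `ℝ^d`
that maps `𝕊ⁿ`-valued fields to `ℝ^{n × k}`-valued fields. It is only applied to symmetric fields;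
every linear map on `𝕊ⁿ` is the restriction of one on all matrices. -/
structure DiffOp (d n k : ℕ) where
  /-- the zeroth-order coefficient -/
  zeroth : Matrix (Fin n) (Fin n) ℝ →ₗ[ℝ] Matrix (Fin n) (Fin k) ℝ
  /-- the coefficients of the partial derivatives -/
  first : Fin d → Matrix (Fin n) (Fin n) ℝ →ₗ[ℝ] Matrix (Fin n) (Fin k) ℝ

/-- The entrywise partial derivative in the direction of the `l`-th coordinate. -/
def partialDeriv {d n : ℕ} (l : Fin d) (Ψ : EuclideanSpace ℝ (Fin d) → Matrix (Fin n) (Fin n) ℝ)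
    (x : EuclideanSpace ℝ (Fin d)) : Matrix (Fin n) (Fin n) ℝ :=
  Matrix.of fun i j => fderiv ℝ (fun y => Ψ y i j) x (EuclideanSpace.single l 1)

/-- `D* Ψ = L₀ Ψ + ∑ l, L_l (∂_l Ψ)`. -/
def DiffOp.apply {d n k : ℕ} (D : DiffOp d n k)
    (Ψ : EuclideanSpace ℝ (Fin d) → Matrix (Fin n) (Fin n) ℝ) (x : EuclideanSpace ℝ (Fin d)) :
    Matrix (Fin n) (Fin k) ℝ :=
  D.zeroth (Ψ x) + ∑ l, D.first l (partialDeriv l Ψ x)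

/-- `C¹` fields of symmetric matrices on `ℝ × ℝ^d`. -/
def IsTestField {d n : ℕ}
    (Φ : ℝ → EuclideanSpace ℝ (Fin d) → Matrix (Fin n) (Fin n) ℝ) : Prop :=
  (∀ t x, (Φ t x).IsSymm) ∧
    ∀ i j, ContDiff ℝ 1 fun p : ℝ × EuclideanSpace ℝ (Fin d) => Φ p.1 p.2 i j

/-- The entrywise time derivative. -/
def timeDeriv {d n : ℕ} (Φ : ℝ → EuclideanSpace ℝ (Fin d) → Matrix (Fin n) (Fin n) ℝ)
    (t : ℝ) (x : EuclideanSpace ℝ (Fin d)) : Matrix (Fin n) (Fin n) ℝ :=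
  Matrix.of fun i j => deriv (fun s => Φ s x i j) t

/-- `(G, q, R) ∈ CE([0,1]; G₀, G₁)`: `G` is `𝕊ⁿ`-valued on `Q = [0,1] × Ω` and
`∂_t G + D q = R^sym + δ₀(t) ⊗ G₀ - δ₁(t) ⊗ G₁` holds weakly, that is,
`∫_Q (∂_t Φ · dG + D*Φ · dq + Φ · dR) = ∫_Ω Φ₁ · dG₁ - ∫_Ω Φ₀ · dG₀` for all `C¹` symmetric `Φ`. -/
def ContinuityEq {d n k : ℕ} (D : DiffOp d n k) {Ω : Set (EuclideanSpace ℝ (Fin d))}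
    (G₀ G₁ : MatrixMeasure Ω n n)
    (G : MatrixMeasure (unitInterval × Ω) n n) (q : MatrixMeasure (unitInterval × Ω) n k)
    (R : MatrixMeasure (unitInterval × Ω) n n) : Prop :=
  G.IsSymm ∧
  ∀ Φ : ℝ → EuclideanSpace ℝ (Fin d) → Matrix (Fin n) (Fin n) ℝ, IsTestField Φ →
    pairing G (fun z => timeDeriv Φ z.1 z.2) + pairing q (fun z => D.apply (Φ z.1) z.2)
        + pairing R (fun z => Φ z.1 z.2)
      = pairing G₁ (fun x => Φ 1 x) - pairing G₀ (fun x => Φ 0 x)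

/-- The squared weighted Wasserstein-Bures distance: the infimum of the action over all curves
connecting `G₀` and `G₁`. -/
def WBsq {d n k : ℕ} (Λ₁ : Matrix (Fin k) (Fin k) ℝ) (Λ₂ : Matrix (Fin n) (Fin n) ℝ)
    (D : DiffOp d n k) {Ω : Set (EuclideanSpace ℝ (Fin d))} (G₀ G₁ : MatrixMeasure Ω n n) : ℝ≥0∞ :=
  ⨅ (G : MatrixMeasure (unitInterval × Ω) n n) (q : MatrixMeasure (unitInterval × Ω) n k)
    (R : MatrixMeasure (unitInterval × Ω) n n) (_ : ContinuityEq D G₀ G₁ G q R),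
    action Λ₁ Λ₂ G q R

/-- The weighted Wasserstein-Bures distance. -/
def WB {d n k : ℕ} (Λ₁ : Matrix (Fin k) (Fin k) ℝ) (Λ₂ : Matrix (Fin n) (Fin n) ℝ)
    (D : DiffOp d n k) {Ω : Set (EuclideanSpace ℝ (Fin d))} (G₀ G₁ : MatrixMeasure Ω n n) : ℝ≥0∞ :=
  WBsq Λ₁ Λ₂ D G₀ G₁ ^ (1 / 2 : ℝ)

end WassersteinBures

end

/-! Everything follows from a Kantorovich duality, `WBsq_eq_iSup`: the squared distance is the
supremum of ⟨G₁, Φ(1)⟩ - ⟨G₀, Φ(0)⟩ over C¹ symmetric fields Φ whose jet (∂ₜΦ, D*Φ, Φ) takes values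
in O_Λ. The admissible Φ do not depend on the endpoints, and each functional is linear and weak-star
continuous in (G₀, G₁). A supremum of such functionals is positively homogeneous, subadditive and
lower semicontinuous; the square root is an order isomorphism of [0, ∞] and commutes with the
supremum.

In the duality, "≥" is the definition of J_Λ applied pointwise. For "≤", let S be the dual value,
assumed finite. Since D*(I) = 0, the field -ctI is a Slater point: its jet lies in the interior of
the constraint set. Hahn-Banach (`exists_extension_le`) then transfers the boundary pairing from
jets to a continuous functional L on all continuous fields of triples, with L ≤ S on the constrained
ones.

L is given by measures (`exists_densities`). The constraint set contains the ray through e₀ = (-I,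
0, 0), so -L is positive along e₀ and Riesz gives a measure λ. The constraint is linear in A and
quadratic in (B, C), so any field φe becomes admissible after adding c(1 + φ²)e₀; this quadratic
bound yields an L²(λ) density in the direction e. The measures solve the continuity equation because
L agrees with the boundary pairing on jets, and their action is at most S because supremum and
integral can be interchanged over a convex set (`lintegral_iSup_le_of_forall_continuous`).

Symmetry of A leaves O_Λ without interior among all triples in general, so the separation uses
`relaxedO`. Jets have symmetric first component, so nothing is lost on them, and boundedness of L on
the larger set makes L blind to antisymmetric A, hence G symmetric. -/

noncomputable section

namespace WassersteinBures

/-! ### Integration of continuous functions against signed measures -/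

section SignedMeasures

variable {X : Type*} [MeasurableSpace X]

lemma integrable_signedMeasure_of_continuous [TopologicalSpace X] [CompactSpace X]
    [OpensMeasurableSpace X] (s : SignedMeasure X) {φ : X → ℝ} (hφ : Continuous φ) :
    VectorMeasure.Integrable s φ := by
  have : IsFiniteMeasure s.variation := by
    rw [← SignedMeasure.totalVariation_eq_variation]; infer_instance
  obtain ⟨C, hC⟩ := isCompact_univ.exists_bound_of_continuousOn hφ.continuousOn
  exact Integrable.of_bound hφ.aestronglyMeasurable C (ae_of_all _ fun x => hC x trivial)

lemma integrable_continuous_mul [TopologicalSpace X] [CompactSpace X]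
    [OpensMeasurableSpace X] {lam : Measure X} {u φ : X → ℝ} (hu : Integrable u lam)
    (hφ : Continuous φ) : Integrable (fun x => φ x * u x) lam := by
  obtain ⟨C, hC⟩ := isCompact_univ.exists_bound_of_continuousOn hφ.continuousOn
  exact hu.bdd_mul hφ.aestronglyMeasurable (ae_of_all _ fun x => hC x trivial)

/-- Splitting the density into positive and negative parts reduces the claim to two finite positive
measures. -/
lemma integral_withDensityᵥ_eq [TopologicalSpace X] [CompactSpace X]
    [OpensMeasurableSpace X] {lam : Measure X} {u φ : X → ℝ} (hu : Integrable u lam)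
    (hφ : Continuous φ) :
    ∫ᵛ x, φ x ∂<•(lam.withDensityᵥ u) = ∫ x, φ x * u x ∂lam := by
  rw [withDensityᵥ_eq_withDensity_pos_part_sub_withDensity_neg_part hu]
  have h1 := isFiniteMeasure_withDensity_ofReal hu.2
  have h2 := isFiniteMeasure_withDensity_ofReal hu.neg.2
  have hm : AEMeasurable (fun x => ENNReal.ofReal (u x)) lam := hu.aemeasurable.ennreal_ofReal
  have hm' : AEMeasurable (fun x => ENNReal.ofReal (-u x)) lam := hu.aemeasurable.neg.ennreal_ofReal
  rw [VectorMeasure.integral_sub_vectorMeasure (integrable_signedMeasure_of_continuous _ hφ)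
    (integrable_signedMeasure_of_continuous _ hφ), VectorMeasure.integral_toSignedMeasure,
    VectorMeasure.integral_toSignedMeasure,
    integral_withDensity_eq_integral_toReal_smul₀ hm (by simp),
    integral_withDensity_eq_integral_toReal_smul₀ hm' (by simp), ← integral_sub]
  · refine integral_congr_ae (ae_of_all _ fun x => ?_)
    simp only [smul_eq_mul, ENNReal.toReal_ofReal']
    rcases le_total 0 (u x) with h | h
    · rw [max_eq_left h, max_eq_right (by linarith)]; ring
    · rw [max_eq_right h, max_eq_left (by linarith)]; ring
  · simpa [mul_comm, ENNReal.toReal_ofReal'] using integrable_continuous_mul hu.pos_part hφ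
  · simpa [mul_comm, ENNReal.toReal_ofReal'] using integrable_continuous_mul hu.neg_part hφ

lemma integral_signedMeasure_eq_integral_rnDeriv [TopologicalSpace X] [CompactSpace X]
    [OpensMeasurableSpace X] {lam : Measure X} [IsFiniteMeasure lam] {s : SignedMeasure X}
    (hs : s.totalVariation ≪ lam) {φ : X → ℝ} (hφ : Continuous φ) :
    ∫ᵛ x, φ x ∂<•s = ∫ x, φ x * s.rnDeriv lam x ∂lam := by
  rw [← integral_withDensityᵥ_eq (SignedMeasure.integrable_rnDeriv s lam) hφ,
    SignedMeasure.withDensityᵥ_rnDeriv_eq]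
  exact (SignedMeasure.totalVariation_absolutelyContinuous_iff s lam).1 hs |> fun h => by
    rw [SignedMeasure.absolutelyContinuous_ennreal_iff]
    simpa using hs

end SignedMeasures

/-! ### Densities in L² and continuous approximation of indicators -/

section L2

variable {X : Type*} [MeasurableSpace X] [MetricSpace X] [CompactSpace X] [BorelSpace X]

/-- A linear functional on `C(X)` that is bounded above by an affine function of `∫ φ²`
has a density in `L²`. -/
lemma exists_density_of_le_integral_sq (lam : Measure X) [IsFiniteMeasure lam]
    (f : C(X, ℝ) →ₗ[ℝ] ℝ) (a c : ℝ)
    (hf : ∀ φ : C(X, ℝ), f φ ≤ a + c * ∫ x, φ x ^ 2 ∂lam) :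
    ∃ u : X → ℝ, Integrable u lam ∧ ∀ φ : C(X, ℝ), f φ = ∫ x, φ x * u x ∂lam := by
  let e := ContinuousMap.toLp (E := ℝ) 2 lam ℝ
  have he : ∀ φ, ‖e φ‖ ^ 2 = ∫ x, φ x ^ 2 ∂lam := by
    intro φ
    rw [← real_inner_self_eq_norm_sq, L2.inner_def]
    refine integral_congr_ae ?_
    filter_upwards [ContinuousMap.coeFn_toLp (p := 2) (𝕜 := ℝ) lam φ] with x hx
    rw [hx]; simp [sq]
  have ha : 0 ≤ a := by simpa using hf 0
  have hb : ∀ φ, f φ ≤ (a + |c|) * ‖e φ‖ := by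
    intro φ
    -- The left side is linear and the right side quadratic under φ ↦ sφ; a suitable s turns the
    -- affine bound into a norm bound.
    have hs : ∀ s : ℝ, s * f φ ≤ a + c * (s ^ 2 * ‖e φ‖ ^ 2) := by
      intro s
      have := hf (s • φ)
      rw [← he, map_smul, map_smul, norm_smul, mul_pow] at this
      simpa using this
    rcases (norm_nonneg (e φ)).eq_or_lt with h0 | h0
    · rw [← h0] at hs ⊢
      by_contra hcon
      push Not at hcon
      -- With ‖e φ‖ = 0 this s would give a + 1 ≤ a.
      have := hs ((a + 1) / f φ)
      rw [div_mul_cancel₀ _ (by linarith)] at this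
      linarith
    · have := hs (1 / ‖e φ‖)
      rw [← mul_pow, one_div_mul_cancel h0.ne', one_div, inv_mul_le_iff₀ h0] at this
      nlinarith [le_abs_self c]
  have hn : ∃ C, ∀ φ, ‖f φ‖ ≤ C * ‖e.toLinearMap φ‖ := by
    refine ⟨a + |c|, fun φ => abs_le'.2 ⟨hb φ, ?_⟩⟩
    simpa using hb (-φ)
  have hd : DenseRange e.toLinearMap :=
    ContinuousMap.toLp_denseRange (p := 2) ℝ lam ℝ (by simp)
  let F := f.extendOfNorm e.toLinearMap
  let u := (InnerProductSpace.toDual ℝ (Lp ℝ 2 lam)).symm F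
  refine ⟨u, (Lp.memLp u).integrable (by norm_num), fun φ => ?_⟩
  rw [← LinearMap.extendOfNorm_eq hd hn φ]
  change F (e φ) = _
  rw [← InnerProductSpace.toDual_symm_apply (𝕜 := ℝ), L2.inner_def]
  refine integral_congr_ae ?_
  filter_upwards [ContinuousMap.coeFn_toLp (p := 2) (𝕜 := ℝ) lam φ] with x hx
  rw [hx]; simp [u]

/-- Indicators of measurable sets are almost everywhere limits of continuous functions
with values in `[0, 1]`. -/
lemma exists_continuous_tendsto_indicator (lam : Measure X) [IsFiniteMeasure lam] {s : Set X}
    (hs : MeasurableSet s) :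
    ∃ χ : ℕ → C(X, ℝ), (∀ k x, 0 ≤ χ k x ∧ χ k x ≤ 1) ∧
      ∀ᵐ x ∂lam, Tendsto (fun k => χ k x) atTop (𝓝 (s.indicator (fun _ => 1) x)) := by
  have hi : MemLp (s.indicator fun _ => (1 : ℝ)) 1 lam :=
    memLp_indicator_const 1 hs 1 (Or.inr (measure_ne_top _ _))
  have := fun k : ℕ => hi.exists_boundedContinuous_eLpNorm_sub_le (by simp)
    (ε := ((k : ℝ≥0∞) + 1)⁻¹) (by simp)
  choose g hg hg' using this
  have ht : Tendsto (fun k => eLpNorm (⇑(g k) - s.indicator fun _ => (1 : ℝ)) 1 lam) atTop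
      (𝓝 0) := by
    refine tendsto_of_tendsto_of_tendsto_of_le_of_le tendsto_const_nhds
      (h := fun k : ℕ => ((k : ℝ≥0∞) + 1)⁻¹) ?_ (fun _ => zero_le) fun k => ?_
    · have := (tendsto_add_atTop_iff_nat 1).2 ENNReal.tendsto_inv_nat_nhds_zero
      simpa using this
    · rw [eLpNorm_sub_comm]; exact hg k
  obtain ⟨ns, -, hns⟩ := (tendstoInMeasure_of_tendsto_eLpNorm one_ne_zero
    (fun k => (g k).continuous.aestronglyMeasurable) hi.1 ht).exists_seq_tendsto_ae
  -- Clamping to [0, 1] keeps the limit, since the indicator is fixed by the clamp.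
  refine ⟨fun k => ⟨fun x => max 0 (min 1 (g (ns k) x)), by fun_prop⟩,
    fun k x => ⟨le_max_left _ _, max_le zero_le_one (min_le_left _ _)⟩, ?_⟩
  filter_upwards [hns] with x hx
  have : s.indicator (fun _ => (1 : ℝ)) x = max 0 (min 1 (s.indicator (fun _ => (1 : ℝ)) x)) := by
    by_cases h : x ∈ s <;> simp [h]
  rw [this]
  exact tendsto_const_nhds.max (tendsto_const_nhds.min hx)

end L2

/-! ### Interchange of integral and pointwise supremum -/

section IntegralSup

variable {X : Type*} [MeasurableSpace X] [MetricSpace X] [CompactSpace X] [BorelSpace X]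
  {E : Type*} [TopologicalSpace E] [AddCommGroup E] [Module ℝ E] [ContinuousSMul ℝ E]
  [IsTopologicalAddGroup E]

/-- The maximum of `0` and the first `N` terms of a sequence. -/
def partialMax (a : ℕ → ℝ) : ℕ → ℝ
  | 0 => 0
  | N + 1 => max (partialMax a N) (a N)

lemma partialMax_nonneg (a : ℕ → ℝ) (N : ℕ) : 0 ≤ partialMax a N := by
  induction N with
  | zero => exact le_rfl
  | succ N ih => exact ih.trans (le_max_left _ _)

lemma partialMax_mono (a : ℕ → ℝ) : Monotone (partialMax a) :=
  monotone_nat_of_le_succ fun _ => le_max_left _ _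

/-- A measurable selection of the best of finitely many points is approximated by continuous fields.
At each stage ξ is blended with the new point p N, with weight close to the indicator of the set
where p N beats the current maximum; convexity keeps the blend in O, and |B x (p N)| + g dominates.
-/
lemma exists_continuous_tendsto_partialMax (lam : Measure X) [IsFiniteMeasure lam] {O : Set E}
    (hO : Convex ℝ O) (h0 : (0 : E) ∈ O) (B : X → E →ₗ[ℝ] ℝ)
    (hm : ∀ p, Measurable fun x => B x p) (hB : ∀ p, Integrable (fun x => B x p) lam)
    (p : ℕ → E) (hp : ∀ i, p i ∈ O) (N : ℕ) :
    Measurable (fun x => partialMax (fun i => B x (p i)) N) ∧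
    ∃ ξ : ℕ → C(X, E), (∀ k x, ξ k x ∈ O) ∧ (∀ k, Measurable fun x => B x (ξ k x)) ∧
      (∃ g : X → ℝ, Integrable g lam ∧ ∀ k x, |B x (ξ k x)| ≤ g x) ∧
      ∀ᵐ x ∂lam, Tendsto (fun k => B x (ξ k x)) atTop
        (𝓝 (partialMax (fun i => B x (p i)) N)) := by
  induction N with
  | zero =>
    refine ⟨measurable_const, fun _ => 0, fun _ _ => h0, fun _ => ?_,
      ⟨0, integrable_zero _ _ _, ?_⟩, ?_⟩
    · simp
    · simp
    · exact ae_of_all _ fun x => by simp [partialMax]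
  | succ N ih =>
    obtain ⟨hM, ξ, hξO, hξm, ⟨g, hg, hξg⟩, hξ⟩ := ih
    refine ⟨hM.max (hm _), ?_⟩
    obtain ⟨χ, hχ, hχs⟩ := exists_continuous_tendsto_indicator lam (measurableSet_lt hM (hm (p N)))
    have hval : ∀ k x, B x (χ k x • p N + (1 - χ k x) • ξ k x)
        = χ k x * B x (p N) + (1 - χ k x) * B x (ξ k x) := by
      intro k x; simp
    refine ⟨fun k => ⟨fun x => χ k x • p N + (1 - χ k x) • ξ k x, by fun_prop⟩,
      fun k x => ?_, fun k => ?_, ⟨fun x => |B x (p N)| + g x, (hB _).abs.add hg, fun k x => ?_⟩, ?_⟩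
    · exact hO (hp N) (hξO k x) (hχ k x).1 (by linarith [(hχ k x).2]) (by ring)
    · simp only [ContinuousMap.coe_mk, hval]
      have := (χ k).continuous.measurable
      exact (this.mul (hm _)).add ((measurable_const.sub this).mul (hξm k))
    · simp only [ContinuousMap.coe_mk, hval]
      obtain ⟨h1, h2⟩ := hχ k x
      refine (abs_add_le _ _).trans (add_le_add ?_ ?_)
      · rw [abs_mul, abs_of_nonneg h1]
        exact mul_le_of_le_one_left (abs_nonneg _) h2
      · rw [abs_mul, abs_of_nonneg (by linarith)]
        exact (mul_le_of_le_one_left (abs_nonneg _) (by linarith)).trans (hξg k x)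
    · filter_upwards [hξ, hχs] with x h1 h2
      simp only [ContinuousMap.coe_mk, hval]
      have := (h2.mul_const (B x (p N))).add ((h2.const_sub 1).mul h1)
      convert this using 2
      simp only [partialMax, Set.indicator_apply, Set.mem_ofPred_eq]
      split_ifs with h
      · rw [max_eq_right h.le]; ring
      · rw [max_eq_left (not_lt.1 h)]; ring

/-- If `∫ B x (ξ x) ≤ S` for all continuous fields `ξ` with values in a convex set `O`, then the
integral of the pointwise supremum of `B x` over `O` is at most `S`. -/
theorem lintegral_iSup_le_of_forall_continuous [SecondCountableTopology E] (lam : Measure X)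
    [IsFiniteMeasure lam] {O : Set E}
    (hO : Convex ℝ O) (h0 : (0 : E) ∈ O) (B : X → E →ₗ[ℝ] ℝ) (hc : ∀ x, Continuous (B x))
    (hm : ∀ p, Measurable fun x => B x p) (hB : ∀ p, Integrable (fun x => B x p) lam) (S : ℝ)
    (h : ∀ ξ : C(X, E), (∀ x, ξ x ∈ O) → ∫ x, B x (ξ x) ∂lam ≤ S) :
    ∫⁻ x, ⨆ p ∈ O, ENNReal.ofReal (B x p) ∂lam ≤ ENNReal.ofReal S := by
  have : Nonempty O := ⟨⟨0, h0⟩⟩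
  let p : ℕ → E := fun i => (TopologicalSpace.denseSeq O i : E)
  have hp : ∀ i, p i ∈ O := fun i => (TopologicalSpace.denseSeq O i).2
  have hsup : ∀ x, ⨆ q ∈ O, ENNReal.ofReal (B x q)
      ≤ ⨆ N, ENNReal.ofReal (partialMax (fun i => B x (p i)) N) := by
    intro x
    refine iSup₂_le fun q hq => ?_
    -- Continuity of B x reduces the bound to the dense sequence.
    have hcl : IsClosed {q : O | ENNReal.ofReal (B x q)
        ≤ ⨆ N, ENNReal.ofReal (partialMax (fun i => B x (p i)) N)} :=
      isClosed_le (ENNReal.continuous_ofReal.comp ((hc x).comp continuous_subtype_val))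
        continuous_const
    have hr : Set.range (TopologicalSpace.denseSeq O) ⊆ {q : O | ENNReal.ofReal (B x q)
        ≤ ⨆ N, ENNReal.ofReal (partialMax (fun i => B x (p i)) N)} := by
      rintro _ ⟨i, rfl⟩
      -- `partialMax` at N sees only the indices below N, so the term i first enters at i + 1.
      exact (ENNReal.ofReal_le_ofReal (le_max_right _ _)).trans
        (le_iSup (fun N => ENNReal.ofReal (partialMax (fun i => B x (p i)) N)) (i + 1))
    exact closure_minimal hr hcl (TopologicalSpace.denseRange_denseSeq O ⟨q, hq⟩)
  refine (lintegral_mono hsup).trans ?_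
  rw [lintegral_iSup
    (fun N => (exists_continuous_tendsto_partialMax lam hO h0 B hm hB p hp N).1.ennreal_ofReal)
    (fun N N' hN x => ENNReal.ofReal_le_ofReal (partialMax_mono _ hN))]
  refine iSup_le fun N => ?_
  obtain ⟨hM, ξ, hξO, hξm, ⟨g, hg, hξg⟩, hξ⟩ :=
    exists_continuous_tendsto_partialMax lam hO h0 B hm hB p hp N
  have hMi : Integrable (fun x => partialMax (fun i => B x (p i)) N) lam := by
    refine hg.mono hM.aestronglyMeasurable ?_
    filter_upwards [hξ] with x hx
    refine (le_of_tendsto hx.norm (Eventually.of_forall fun k => hξg k x)).trans (le_abs_self _)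
  rw [← ofReal_integral_eq_lintegral_ofReal hMi (ae_of_all _ fun x => partialMax_nonneg _ _)]
  refine ENNReal.ofReal_le_ofReal ?_
  have := tendsto_integral_of_dominated_convergence g (fun k => (hξm k).aestronglyMeasurable) hg
    (fun k => ae_of_all _ (hξg k)) hξ
  exact le_of_tendsto this (Eventually.of_forall fun k => h _ (hξO k))

end IntegralSup

/-! ### Riesz representation of functionals bounded on a constraint set -/

section Representation

variable {X : Type*} [MeasurableSpace X] [MetricSpace X] [CompactSpace X] [BorelSpace X]
  {E : Type*} [TopologicalSpace E] [AddCommGroup E] [Module ℝ E] [ContinuousSMul ℝ E]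
  [IsTopologicalAddGroup E]

/-- The field `x ↦ φ x • e`. -/
def fieldOf (e : E) : C(X, ℝ) →ₗ[ℝ] C(X, E) where
  toFun φ := ⟨fun x => φ x • e, by fun_prop⟩
  map_add' φ ψ := by ext x; simp [add_smul]
  map_smul' s φ := by ext x; simp [mul_smul]

omit [MeasurableSpace X] [CompactSpace X] [BorelSpace X] in
@[simp] lemma fieldOf_apply (e : E) (φ : C(X, ℝ)) (x : X) : fieldOf e φ x = φ x • e := rfl

/-- The Riesz-Markov-Kakutani theorem on a compact metric space. -/
lemma exists_measure_of_nonneg (f : C(X, ℝ) →ₗ[ℝ] ℝ) (hf : ∀ φ : C(X, ℝ), 0 ≤ φ → 0 ≤ f φ) :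
    ∃ lam : Measure X, IsFiniteMeasure lam ∧ ∀ φ : C(X, ℝ), f φ = ∫ x, φ x ∂lam := by
  let F : CompactlySupportedContinuousMap X ℝ →ₗ[ℝ] ℝ :=
    { toFun := fun φ => f φ.toContinuousMap
      map_add' := fun φ ψ => f.map_add _ _
      map_smul' := fun s φ => f.map_smul _ _ }
  let P : CompactlySupportedContinuousMap X ℝ →ₚ[ℝ] ℝ :=
    PositiveLinearMap.mk₀ F fun φ hφ => hf _ hφ
  refine ⟨RealRMK.rieszMeasure P, inferInstance, fun φ => ?_⟩
  exact (RealRMK.integral_rieszMeasure P (CompactlySupportedContinuousMap.continuousMapEquiv φ)).symm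

/-- A functional on continuous fields that is bounded above on the fields with values in a set `O`
is given by integrable densities, if `O` absorbs all directions in a suitable quadratic sense. -/
theorem exists_densities {O : Set E} {e₀ : E} (h0 : ∀ s : ℝ, 0 ≤ s → s • e₀ ∈ O)
    (he : ∀ e : E, ∃ c : ℝ, ∀ t : ℝ, t • e + (c * (1 + t ^ 2)) • e₀ ∈ O)
    (L : C(X, E) →ₗ[ℝ] ℝ) (S : ℝ) (hL : ∀ ξ : C(X, E), (∀ x, ξ x ∈ O) → L ξ ≤ S) :
    ∃ lam : Measure X, IsFiniteMeasure lam ∧ ∀ e : E, ∃ u : X → ℝ, Integrable u lam ∧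
      ∀ φ : C(X, ℝ), L (fieldOf e φ) = ∫ x, φ x * u x ∂lam := by
  obtain ⟨lam, hlam, h⟩ := exists_measure_of_nonneg (X := X) (-(L ∘ₗ fieldOf e₀)) (by
    intro φ hφ
    simp only [LinearMap.neg_apply, LinearMap.comp_apply]
    by_contra hcon
    push Not at hcon
    have hpos : 0 < L (fieldOf e₀ φ) := by linarith
    -- A positive value could be scaled past S, because nonnegative multiples of e₀ stay in O.
    have := hL (((|S| + 1) / L (fieldOf e₀ φ)) • fieldOf e₀ φ) fun x => by
      simp only [ContinuousMap.smul_apply, fieldOf_apply, smul_smul]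
      exact h0 _ (mul_nonneg (by positivity) (hφ x))
    rw [map_smul, smul_eq_mul, div_mul_cancel₀ _ hpos.ne'] at this
    linarith [le_abs_self S])
  refine ⟨lam, hlam, fun e => ?_⟩
  obtain ⟨c, hc⟩ := he e
  refine exists_density_of_le_integral_sq lam (L ∘ₗ fieldOf e) (S + c * ∫ _, (1 : ℝ) ∂lam) c
    fun φ => ?_
  -- The correction along e₀ makes φe admissible, and its cost is exactly c ∫ (1 + φ²) dλ.
  have h1 := hL (fieldOf e φ + c • fieldOf e₀ (1 + φ ^ 2)) fun x => by
    simpa [smul_smul, mul_add, add_smul] using hc (φ x)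
  have h2 := h (1 + φ ^ 2)
  simp only [LinearMap.neg_apply, LinearMap.comp_apply] at h2
  have h3 : ∫ x, (1 + φ ^ 2 : C(X, ℝ)) x ∂lam = ∫ _, (1 : ℝ) ∂lam + ∫ x, φ x ^ 2 ∂lam := by
    have hi : Integrable (fun x => φ x ^ 2) lam :=
      (φ ^ 2).continuous.integrable_of_hasCompactSupport (HasCompactSupport.of_compactSpace _)
    rw [← integral_add (integrable_const _) hi]
    rfl
  rw [map_add, map_smul, smul_eq_mul] at h1
  rw [h3] at h2
  have h4 : L (fieldOf e₀ (1 + φ ^ 2)) = -(∫ _, (1 : ℝ) ∂lam + ∫ x, φ x ^ 2 ∂lam) := by linarith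
  rw [h4] at h1
  simp only [LinearMap.comp_apply]
  linarith

end Representation

/-! ### Hahn-Banach separation under a Slater condition -/

section Separation

variable {V P : Type*} [TopologicalSpace V] [AddCommGroup V] [Module ℝ V]
  [IsTopologicalAddGroup V] [ContinuousSMul ℝ V] [AddCommGroup P] [Module ℝ P]

/-- Convex duality under a Slater condition. -/
theorem exists_extension_le {K : Set V} (hK : Convex ℝ K) (hKo : IsOpen K) (T : P →ₗ[ℝ] V)
    (b : P →ₗ[ℝ] ℝ) (S : ℝ) (hb : ∀ φ, T φ ∈ K → b φ ≤ S) (hS : ∃ φ, T φ ∈ K) :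
    ∃ L : V →L[ℝ] ℝ, (∀ φ, L (T φ) = b φ) ∧ ∀ ξ ∈ K, L ξ ≤ S := by
  obtain ⟨f, u, hf, hu⟩ := geometric_hahn_banach_open (s := K ×ˢ Set.Ioi S)
    (t := (LinearMap.range (T.prod b) : Set (V × ℝ))) (hK.prod (convex_Ioi S))
    (hKo.prod isOpen_Ioi) (Submodule.convex _) (by
      rw [Set.disjoint_left]
      rintro _ ⟨h1, h2⟩ ⟨φ, rfl⟩
      exact absurd (hb φ h1) (not_le.2 h2))
  have hu0 : u ≤ 0 := by simpa using hu 0 (Submodule.zero_mem _)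
  have hf0 : ∀ φ, f (T φ, b φ) = 0 := by
    intro φ
    by_contra hne
    -- A linear functional bounded below on a subspace vanishes there; this multiple would take the
    -- value u - 1.
    have := hu (((u - 1) / f (T φ, b φ)) • (T φ, b φ)) (Submodule.smul_mem _ _ ⟨φ, rfl⟩)
    rw [map_smul, smul_eq_mul, div_mul_cancel₀ _ hne] at this
    linarith
  have hsplit : ∀ ξ r, f (ξ, r) = f (ξ, 0) + r * f (0, 1) := by
    intro ξ r
    rw [← smul_eq_mul, ← map_smul, ← map_add]
    simp
  -- The separating hyperplane is not vertical: at a Slater point, f is zero at height b φ ≤ S and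
  -- negative at height S + 1.
  have hneg : f (0, 1) < 0 := by
    obtain ⟨φ, hφ⟩ := hS
    have h1 := hf (T φ, S + 1) ⟨hφ, by simp⟩
    have h2 := hf0 φ
    rw [hsplit] at h1 h2
    have := hb φ hφ
    by_contra hcon
    push Not at hcon
    nlinarith
  refine ⟨(-f (0, 1))⁻¹ • f.comp (ContinuousLinearMap.inl ℝ V ℝ), fun φ => ?_, fun ξ hξ => ?_⟩
  · have := hf0 φ
    rw [hsplit] at this
    simp only [_root_.smul_apply, ContinuousLinearMap.comp_apply,
      ContinuousLinearMap.inl_apply, smul_eq_mul]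
    rw [inv_mul_eq_iff_eq_mul₀ (by linarith)]
    linarith
  · simp only [_root_.smul_apply, ContinuousLinearMap.comp_apply,
      ContinuousLinearMap.inl_apply, smul_eq_mul]
    rw [inv_mul_le_iff₀ (by linarith)]
    -- Separation only speaks of heights r > S; the bound at S is the limit r ↓ S.
    have hlim : ∀ r, S < r → f (ξ, 0) ≤ r * -f (0, 1) := by
      intro r hr
      have := hf (ξ, r) ⟨hξ, hr⟩
      rw [hsplit] at this
      linarith
    rw [mul_comm]
    refine ge_of_tendsto (f := fun r => r * -f (0, 1)) (x := 𝓝[>] S) ?_ ?_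
    · exact (tendsto_id.mul_const _).mono_left nhdsWithin_le_nhds
    · filter_upwards [self_mem_nhdsWithin] with r hr using hlim r hr

omit [TopologicalSpace V] [IsTopologicalAddGroup V] [ContinuousSMul ℝ V] in
/-- A linear functional that is at most `S` on the interior of a convex set is at most `S` on all
points that are joined to the interior. -/
lemma le_of_forall_combo_le (L : V →ₗ[ℝ] ℝ) {S : ℝ} (ξ ξ₀ : V)
    (h : ∀ s : ℝ, 0 < s → s < 1 → L ((1 - s) • ξ + s • ξ₀) ≤ S) : L ξ ≤ S := by
  have ht : Tendsto (fun s : ℝ => (1 - s) * L ξ + s * L ξ₀) (𝓝[>] 0)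
      (𝓝 ((1 - 0) * L ξ + 0 * L ξ₀)) := by
    refine Tendsto.mono_left ?_ nhdsWithin_le_nhds
    exact Continuous.tendsto (by fun_prop) _
  simp only [sub_zero, one_mul, zero_mul, add_zero] at ht
  refine le_of_tendsto ht ?_
  filter_upwards [Ioo_mem_nhdsGT (show (0 : ℝ) < 1 by norm_num)] with s hs
  simpa using h s hs.1 hs.2

end Separation

/-! ### Geometry of the set O_Λ and its relaxation -/

section Relaxation

variable {n k : ℕ}

/-- The space of triples `(A, B, C)`. -/
abbrev Triple (n k : ℕ) : Type :=
  Matrix (Fin n) (Fin n) ℝ × Matrix (Fin n) (Fin k) ℝ × Matrix (Fin n) (Fin n) ℝ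

/-- The set `O_Λ` without the symmetry constraint on `A`. -/
def relaxedO (Λ₁ : Matrix (Fin k) (Fin k) ℝ) (Λ₂ : Matrix (Fin n) (Fin n) ℝ) :
    Set (Triple n k) :=
  {p | ∀ v : Fin n → ℝ, v ⬝ᵥ p.1 *ᵥ v + (1 / 2) * (v ⬝ᵥ (p.2.1 * Λ₁ ^ 2 * p.2.1ᵀ) *ᵥ v)
    + (1 / 2) * (v ⬝ᵥ (p.2.2 * Λ₂ ^ 2 * p.2.2ᵀ) *ᵥ v) ≤ 0}

lemma isSymm_mul_sq_mul_transpose {m l : ℕ} {Λ : Matrix (Fin l) (Fin l) ℝ} (hΛ : Λ.IsSymm)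
    (B : Matrix (Fin m) (Fin l) ℝ) : (B * Λ ^ 2 * Bᵀ).IsSymm := by
  unfold Matrix.IsSymm at *
  simp [Matrix.transpose_mul, Matrix.transpose_pow, hΛ, Matrix.mul_assoc]

/-- Positive semidefiniteness includes symmetry, which here follows from that of A, Λ₁ and Λ₂; only
the quadratic form inequality remains. -/
lemma mem_setO_iff {Λ₁ : Matrix (Fin k) (Fin k) ℝ} {Λ₂ : Matrix (Fin n) (Fin n) ℝ}
    (h₁ : Λ₁.IsSymm) (h₂ : Λ₂.IsSymm) {p : Triple n k} :
    p ∈ setO Λ₁ Λ₂ ↔ p.1.IsSymm ∧ p ∈ relaxedO Λ₁ Λ₂ := by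
  refine and_congr_right fun hs => ?_
  rw [Matrix.posSemidef_iff_dotProduct_mulVec]
  have hH : (-(p.1 + (1 / 2 : ℝ) • (p.2.1 * Λ₁ ^ 2 * p.2.1ᵀ)
      + (1 / 2 : ℝ) • (p.2.2 * Λ₂ ^ 2 * p.2.2ᵀ))).IsHermitian := by
    rw [Matrix.isHermitian_iff_isSymm]
    exact ((hs.add ((isSymm_mul_sq_mul_transpose h₁ _).smul _)).add
      ((isSymm_mul_sq_mul_transpose h₂ _).smul _)).neg
  simp only [hH, true_and, relaxedO, Set.mem_ofPred_eq]
  refine forall_congr' fun v => ?_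
  simp only [star_trivial, Matrix.neg_mulVec, Matrix.add_mulVec, Matrix.smul_mulVec,
    dotProduct_neg, dotProduct_add, dotProduct_smul, smul_eq_mul]
  constructor <;> intro h <;> linarith

/-- As Λ is symmetric, the form is |ΛBᵀv|², a squared norm of something linear in B. Convexity of
O_Λ rests on this. -/
lemma dotProduct_mul_sq_mul_transpose {m l : ℕ} {Λ : Matrix (Fin l) (Fin l) ℝ} (hΛ : Λ.IsSymm)
    (B : Matrix (Fin m) (Fin l) ℝ) (v : Fin m → ℝ) :
    v ⬝ᵥ (B * Λ ^ 2 * Bᵀ) *ᵥ v = (Λ *ᵥ (Bᵀ *ᵥ v)) ⬝ᵥ (Λ *ᵥ (Bᵀ *ᵥ v)) := by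
  have h : B * Λ ^ 2 * Bᵀ = (Λ * Bᵀ)ᵀ * (Λ * Bᵀ) := by
    rw [Matrix.transpose_mul, Matrix.transpose_transpose, hΛ.eq, sq]
    simp only [Matrix.mul_assoc]
  rw [h, ← Matrix.mulVec_mulVec, Matrix.dotProduct_mulVec, Matrix.vecMul_transpose,
    Matrix.mulVec_mulVec]

lemma dotProduct_self_combo_le {l : ℕ} (w w' : Fin l → ℝ) {a b : ℝ} (ha : 0 ≤ a) (hb : 0 ≤ b)
    (hab : a + b = 1) :
    (a • w + b • w') ⬝ᵥ (a • w + b • w') ≤ a * (w ⬝ᵥ w) + b * (w' ⬝ᵥ w') := by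
  simp only [dotProduct, Finset.mul_sum, ← Finset.sum_add_distrib]
  refine Finset.sum_le_sum fun i _ => ?_
  simp only [Pi.add_apply, Pi.smul_apply, smul_eq_mul]
  obtain rfl : b = 1 - a := by linarith
  nlinarith [mul_nonneg (mul_nonneg ha hb) (sq_nonneg (w i - w' i))]

lemma dotProduct_combo_le {m l : ℕ} {Λ : Matrix (Fin l) (Fin l) ℝ} (hΛ : Λ.IsSymm)
    (B B' : Matrix (Fin m) (Fin l) ℝ) (v : Fin m → ℝ) {a b : ℝ} (ha : 0 ≤ a) (hb : 0 ≤ b)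
    (hab : a + b = 1) :
    v ⬝ᵥ ((a • B + b • B') * Λ ^ 2 * (a • B + b • B')ᵀ) *ᵥ v
      ≤ a * (v ⬝ᵥ (B * Λ ^ 2 * Bᵀ) *ᵥ v) + b * (v ⬝ᵥ (B' * Λ ^ 2 * B'ᵀ) *ᵥ v) := by
  simp only [dotProduct_mul_sq_mul_transpose hΛ]
  convert dotProduct_self_combo_le (Λ *ᵥ (Bᵀ *ᵥ v)) (Λ *ᵥ (B'ᵀ *ᵥ v)) ha hb hab using 2 <;>
  simp [Matrix.transpose_add, Matrix.transpose_smul, Matrix.add_mulVec, Matrix.smul_mulVec,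
    Matrix.mulVec_add, Matrix.mulVec_smul]

lemma convex_relaxedO {Λ₁ : Matrix (Fin k) (Fin k) ℝ} {Λ₂ : Matrix (Fin n) (Fin n) ℝ}
    (h₁ : Λ₁.IsSymm) (h₂ : Λ₂.IsSymm) : Convex ℝ (relaxedO Λ₁ Λ₂) := by
  intro p hp q hq a b ha hb hab v
  have e1 := dotProduct_combo_le h₁ p.2.1 q.2.1 v ha hb hab
  have e2 := dotProduct_combo_le h₂ p.2.2 q.2.2 v ha hb hab
  have e3 := mul_nonneg ha (neg_nonneg.2 (hp v))
  have e4 := mul_nonneg hb (neg_nonneg.2 (hq v))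
  simp only [Prod.fst_add, Prod.snd_add, Prod.smul_fst, Prod.smul_snd, Matrix.add_mulVec,
    Matrix.smul_mulVec, dotProduct_add, dotProduct_smul, smul_eq_mul]
  linarith

lemma convex_setO {Λ₁ : Matrix (Fin k) (Fin k) ℝ} {Λ₂ : Matrix (Fin n) (Fin n) ℝ}
    (h₁ : Λ₁.IsSymm) (h₂ : Λ₂.IsSymm) : Convex ℝ (setO Λ₁ Λ₂) := by
  intro p hp q hq a b ha hb hab
  rw [mem_setO_iff h₁ h₂] at *
  exact ⟨(hp.1.smul a).add (hq.1.smul b), convex_relaxedO h₁ h₂ hp.2 hq.2 ha hb hab⟩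

lemma zero_mem_setO (Λ₁ : Matrix (Fin k) (Fin k) ℝ) (Λ₂ : Matrix (Fin n) (Fin n) ℝ) :
    (0 : Triple n k) ∈ setO Λ₁ Λ₂ := by
  refine ⟨Matrix.isSymm_zero, ?_⟩
  simpa using Matrix.PosSemidef.zero

/-- The entrywise `ℓ¹` norm. -/
def entrySum {m l : ℕ} (M : Matrix (Fin m) (Fin l) ℝ) : ℝ := ∑ i, ∑ j, |M i j|

lemma entrySum_smul {m l : ℕ} (t : ℝ) (M : Matrix (Fin m) (Fin l) ℝ) :
    entrySum (t • M) = |t| * entrySum M := by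
  simp [entrySum, abs_mul, Finset.mul_sum]

lemma entrySum_nonneg {m l : ℕ} (M : Matrix (Fin m) (Fin l) ℝ) : 0 ≤ entrySum M :=
  Finset.sum_nonneg fun _ _ => Finset.sum_nonneg fun _ _ => abs_nonneg _

lemma continuous_entrySum {m l : ℕ} :
    Continuous (entrySum : Matrix (Fin m) (Fin l) ℝ → ℝ) := by
  unfold entrySum
  exact continuous_finsetSum _ fun i _ => continuous_finsetSum _ fun j _ =>
    (continuous_id.matrix_elem i j).abs

lemma dotProduct_mulVec_le_entrySum (M : Matrix (Fin n) (Fin n) ℝ) (v : Fin n → ℝ) :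
    v ⬝ᵥ M *ᵥ v ≤ entrySum M * (v ⬝ᵥ v) := by
  have hl : v ⬝ᵥ M *ᵥ v = ∑ i, ∑ j, v i * (M i j * v j) := by
    simp only [dotProduct, Matrix.mulVec, Finset.mul_sum]
  have hr : entrySum M * (v ⬝ᵥ v) = ∑ i, ∑ j, |M i j| * ∑ l, v l * v l := by
    unfold entrySum dotProduct
    generalize ∑ l, v l * v l = c
    simp only [Finset.sum_mul]
  rw [hl, hr]
  refine Finset.sum_le_sum fun i _ => Finset.sum_le_sum fun j _ => ?_
  have hi : v i * v i ≤ ∑ l, v l * v l :=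
    Finset.single_le_sum (f := fun l => v l * v l) (fun l _ => mul_self_nonneg _) (Finset.mem_univ i)
  have hj : v j * v j ≤ ∑ l, v l * v l :=
    Finset.single_le_sum (f := fun l => v l * v l) (fun l _ => mul_self_nonneg _) (Finset.mem_univ j)
  have hij : |v i * v j| ≤ ∑ l, v l * v l := by
    rw [abs_le]
    constructor <;> nlinarith [sq_nonneg (v i - v j), sq_nonneg (v i + v j)]
  calc v i * (M i j * v j) = M i j * (v i * v j) := by ring
    _ ≤ |M i j * (v i * v j)| := le_abs_self _
    _ = |M i j| * |v i * v j| := abs_mul _ _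
    _ ≤ _ := mul_le_mul_of_nonneg_left hij (abs_nonneg _)

lemma sum_sq_dotProduct_nonneg (v : Fin n → ℝ) : 0 ≤ v ⬝ᵥ v :=
  Finset.sum_nonneg fun _ _ => mul_self_nonneg _

/-- If `A + ε I`, `B` and `C` are small compared to `ε`, then `(A, B, C)` satisfies the matrix
inequality. -/
lemma mem_relaxedO_of_entrySum_le {Λ₁ : Matrix (Fin k) (Fin k) ℝ} {Λ₂ : Matrix (Fin n) (Fin n) ℝ}
    {p : Triple n k} {ε : ℝ}
    (h : entrySum (p.1 + ε • 1) + (1 / 2) * entrySum (p.2.1 * Λ₁ ^ 2 * p.2.1ᵀ)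
      + (1 / 2) * entrySum (p.2.2 * Λ₂ ^ 2 * p.2.2ᵀ) ≤ ε) : p ∈ relaxedO Λ₁ Λ₂ := by
  intro v
  have e1 := dotProduct_mulVec_le_entrySum (p.1 + ε • 1) v
  have e2 := dotProduct_mulVec_le_entrySum (p.2.1 * Λ₁ ^ 2 * p.2.1ᵀ) v
  have e3 := dotProduct_mulVec_le_entrySum (p.2.2 * Λ₂ ^ 2 * p.2.2ᵀ) v
  have e4 := mul_le_mul_of_nonneg_right h (sum_sq_dotProduct_nonneg v)
  simp only [Matrix.add_mulVec, Matrix.smul_mulVec, Matrix.one_mulVec, dotProduct_add,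
    dotProduct_smul, smul_eq_mul] at e1
  linarith

lemma mem_interior_relaxedO {Λ₁ : Matrix (Fin k) (Fin k) ℝ} {Λ₂ : Matrix (Fin n) (Fin n) ℝ}
    {p : Triple n k} {ε : ℝ}
    (h : entrySum (p.1 + ε • 1) + (1 / 2) * entrySum (p.2.1 * Λ₁ ^ 2 * p.2.1ᵀ)
      + (1 / 2) * entrySum (p.2.2 * Λ₂ ^ 2 * p.2.2ᵀ) < ε) : p ∈ interior (relaxedO Λ₁ Λ₂) := by
  have hc : Continuous fun p : Triple n k =>
      entrySum (p.1 + ε • 1) + (1 / 2) * entrySum (p.2.1 * Λ₁ ^ 2 * p.2.1ᵀ)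
      + (1 / 2) * entrySum (p.2.2 * Λ₂ ^ 2 * p.2.2ᵀ) := by
    refine ((continuous_entrySum.comp (by fun_prop)).add (continuous_const.mul
      (continuous_entrySum.comp ?_))).add (continuous_const.mul (continuous_entrySum.comp ?_))
    · exact ((continuous_snd.fst).matrix_mul continuous_const).matrix_mul
        (continuous_snd.fst).matrix_transpose
    · exact ((continuous_snd.snd).matrix_mul continuous_const).matrix_mul
        (continuous_snd.snd).matrix_transpose
  exact interior_maximal (fun q hq => mem_relaxedO_of_entrySum_le (le_of_lt hq))
    (isOpen_lt hc continuous_const) h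

lemma smul_neg_one_mem_relaxedO (Λ₁ : Matrix (Fin k) (Fin k) ℝ) (Λ₂ : Matrix (Fin n) (Fin n) ℝ)
    {s : ℝ} (hs : 0 ≤ s) : s • ((-1, 0, 0) : Triple n k) ∈ relaxedO Λ₁ Λ₂ :=
  mem_relaxedO_of_entrySum_le (ε := s) (by simpa [entrySum] using hs)

/-- The multiple of -I has to absorb a term growing like |t| from A and terms growing like t² from B
and C. Both |t| and t² are at most 1 + t², so c can be the sum of the three sizes at t = 1. -/
lemma exists_add_smul_neg_one_mem_relaxedO (Λ₁ : Matrix (Fin k) (Fin k) ℝ)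
    (Λ₂ : Matrix (Fin n) (Fin n) ℝ) (e : Triple n k) :
    ∃ c : ℝ, ∀ t : ℝ, t • e + (c * (1 + t ^ 2)) • ((-1, 0, 0) : Triple n k) ∈ relaxedO Λ₁ Λ₂ := by
  refine ⟨entrySum e.1 + (1 / 2) * entrySum (e.2.1 * Λ₁ ^ 2 * e.2.1ᵀ)
    + (1 / 2) * entrySum (e.2.2 * Λ₂ ^ 2 * e.2.2ᵀ), fun t => mem_relaxedO_of_entrySum_le
      (ε := (entrySum e.1 + (1 / 2) * entrySum (e.2.1 * Λ₁ ^ 2 * e.2.1ᵀ)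
    + (1 / 2) * entrySum (e.2.2 * Λ₂ ^ 2 * e.2.2ᵀ)) * (1 + t ^ 2)) ?_⟩
  have h1 := entrySum_nonneg e.1
  have h2 := entrySum_nonneg (e.2.1 * Λ₁ ^ 2 * e.2.1ᵀ)
  have h3 := entrySum_nonneg (e.2.2 * Λ₂ ^ 2 * e.2.2ᵀ)
  simp only [Prod.fst_add, Prod.snd_add, Prod.smul_fst, Prod.smul_snd, smul_zero, add_zero,
    smul_neg, neg_add_cancel_right, Matrix.transpose_smul, Matrix.smul_mul, Matrix.mul_smul,
    entrySum_smul]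
  have ht : |t| ≤ 1 + t ^ 2 := by
    rw [abs_le]; constructor <;> nlinarith [sq_nonneg (t - 1), sq_nonneg (t + 1)]
  have ht' : |t| * |t| ≤ 1 + t ^ 2 := by rw [abs_mul_abs_self]; nlinarith
  nlinarith [mul_le_mul_of_nonneg_right ht h1, mul_le_mul_of_nonneg_right ht' h2,
    mul_le_mul_of_nonneg_right ht' h3]

end Relaxation

/-! ### Pairings, densities and the weak duality inequality -/

section Pairing

variable {X : Type*} [MeasurableSpace X] {m l n k : ℕ}

lemma frob_eq_sum (A B : Matrix (Fin m) (Fin l) ℝ) : frob A B = ∑ i, ∑ j, B i j * A i j := by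
  rw [frob, Matrix.trace, Finset.sum_comm]
  simp [Matrix.diag, Matrix.mul_apply, mul_comm]

lemma continuous_frob (A : Matrix (Fin m) (Fin l) ℝ) : Continuous (frob A) := by
  simp only [funext (frob_eq_sum A)]
  exact continuous_finsetSum _ fun i _ => continuous_finsetSum _ fun j _ =>
    (continuous_id.matrix_elem i j).mul continuous_const

lemma measurable_frob_density (G : MatrixMeasure X m l) (lam : Measure X)
    (A : Matrix (Fin m) (Fin l) ℝ) : Measurable fun x => frob (density G lam x) A := by
  simp only [frob_eq_sum, density, Matrix.of_apply]
  exact Finset.measurable_sum _ fun i _ => Finset.measurable_sum _ fun j _ =>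
    measurable_const.mul (SignedMeasure.measurable_rnDeriv _ _)

lemma integrable_frob_density_const (G : MatrixMeasure X m l) (lam : Measure X)
    (A : Matrix (Fin m) (Fin l) ℝ) : Integrable (fun x => frob (density G lam x) A) lam := by
  simp only [frob_eq_sum, density, Matrix.of_apply]
  exact integrable_finsetSum _ fun i _ => integrable_finsetSum _ fun j _ =>
    (SignedMeasure.integrable_rnDeriv _ _).const_mul _

instance (G : MatrixMeasure X m l) : IsFiniteMeasure (entryVariation G) := by
  refine ⟨?_⟩
  simp only [entryVariation, Measure.finsetSum_apply]
  exact ENNReal.sum_lt_top.2 fun i _ => ENNReal.sum_lt_top.2 fun j _ => measure_lt_top _ _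

lemma totalVariation_le_entryVariation (G : MatrixMeasure X m l) (i : Fin m) (j : Fin l) :
    (G i j).totalVariation ≤ entryVariation G := by
  unfold entryVariation
  exact (Finset.single_le_sum (f := fun j => (G i j).totalVariation)
    (fun _ _ => Measure.zero_le _) (Finset.mem_univ j)).trans
    (Finset.single_le_sum (f := fun i => ∑ j, (G i j).totalVariation)
      (fun _ _ => Measure.zero_le _) (Finset.mem_univ i))

variable [TopologicalSpace X] [CompactSpace X] [OpensMeasurableSpace X]

lemma integrable_frob_density (G : MatrixMeasure X m l) (lam : Measure X)
    {Φ : X → Matrix (Fin m) (Fin l) ℝ} (hΦ : Continuous Φ) :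
    Integrable (fun x => frob (density G lam x) (Φ x)) lam := by
  simp only [frob_eq_sum, density, Matrix.of_apply]
  exact integrable_finsetSum _ fun i _ => integrable_finsetSum _ fun j _ =>
    integrable_continuous_mul (SignedMeasure.integrable_rnDeriv _ _) (hΦ.matrix_elem i j)

lemma pairing_eq_integral_frob (G : MatrixMeasure X m l) {lam : Measure X} [IsFiniteMeasure lam]
    (hG : entryVariation G ≤ lam) {Φ : X → Matrix (Fin m) (Fin l) ℝ} (hΦ : Continuous Φ) :
    pairing G Φ = ∫ x, frob (density G lam x) (Φ x) ∂lam := by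
  have hi : ∀ i j, Integrable (fun x => Φ x i j * (G i j).rnDeriv lam x) lam := fun i j =>
    integrable_continuous_mul (SignedMeasure.integrable_rnDeriv _ _) (hΦ.matrix_elem i j)
  simp only [frob_eq_sum, density, Matrix.of_apply, pairing]
  rw [integral_finsetSum _ fun i _ => integrable_finsetSum _ fun j _ => hi i j]
  refine Finset.sum_congr rfl fun i _ => ?_
  rw [integral_finsetSum _ fun j _ => hi i j]
  refine Finset.sum_congr rfl fun j _ => ?_
  exact integral_signedMeasure_eq_integral_rnDeriv (Measure.absolutelyContinuous_of_le
    ((totalVariation_le_entryVariation G i j).trans hG)) (hΦ.matrix_elem i j)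

lemma pairing_add_measure (G H : MatrixMeasure X m l)
    {Φ : X → Matrix (Fin m) (Fin l) ℝ} (hΦ : Continuous Φ) :
    pairing (G + H) Φ = pairing G Φ + pairing H Φ := by
  simp only [pairing, ← Finset.sum_add_distrib]
  refine Finset.sum_congr rfl fun i _ => Finset.sum_congr rfl fun j _ => ?_
  exact VectorMeasure.integral_add_vectorMeasure
    (integrable_signedMeasure_of_continuous _ (hΦ.matrix_elem i j))
    (integrable_signedMeasure_of_continuous _ (hΦ.matrix_elem i j))

omit [TopologicalSpace X] [CompactSpace X] [OpensMeasurableSpace X] in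
lemma pairing_smul_measure (α : ℝ) (G : MatrixMeasure X m l) (Φ : X → Matrix (Fin m) (Fin l) ℝ) :
    pairing (α • G) Φ = α * pairing G Φ := by
  simp only [pairing, Finset.mul_sum]
  refine Finset.sum_congr rfl fun i _ => Finset.sum_congr rfl fun j _ => ?_
  exact VectorMeasure.integral_smul_vectorMeasure _ _

lemma pairing_add (G : MatrixMeasure X m l)
    {Φ Ψ : X → Matrix (Fin m) (Fin l) ℝ} (hΦ : Continuous Φ) (hΨ : Continuous Ψ) :
    pairing G (fun x => Φ x + Ψ x) = pairing G Φ + pairing G Ψ := by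
  simp only [pairing, ← Finset.sum_add_distrib]
  refine Finset.sum_congr rfl fun i _ => Finset.sum_congr rfl fun j _ => ?_
  exact VectorMeasure.integral_fun_add
    (integrable_signedMeasure_of_continuous _ (hΦ.matrix_elem i j))
    (integrable_signedMeasure_of_continuous _ (hΨ.matrix_elem i j))

omit [TopologicalSpace X] [CompactSpace X] [OpensMeasurableSpace X] in
lemma pairing_smul (α : ℝ) (G : MatrixMeasure X m l) (Φ : X → Matrix (Fin m) (Fin l) ℝ) :
    pairing G (fun x => α • Φ x) = α * pairing G Φ := by
  simp only [pairing, Finset.mul_sum]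
  refine Finset.sum_congr rfl fun i _ => Finset.sum_congr rfl fun j _ => ?_
  exact VectorMeasure.integral_fun_smul _ _ _ _

omit [TopologicalSpace X] [CompactSpace X] [OpensMeasurableSpace X] in
lemma ofReal_integral_le_lintegral {lam : Measure X} {f : X → ℝ} (hf : Integrable f lam) :
    ENNReal.ofReal (∫ x, f x ∂lam) ≤ ∫⁻ x, ENNReal.ofReal (f x) ∂lam := by
  calc ENNReal.ofReal (∫ x, f x ∂lam) ≤ ENNReal.ofReal (∫ x, max (f x) 0 ∂lam) :=
        ENNReal.ofReal_le_ofReal (integral_mono hf hf.pos_part fun x => le_max_left _ _)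
    _ = ∫⁻ x, ENNReal.ofReal (max (f x) 0) ∂lam :=
        ofReal_integral_eq_lintegral_ofReal hf.pos_part (ae_of_all _ fun x => le_max_right _ _)
    _ = _ := by simp [ENNReal.ofReal_max]

/-- `(A, B, C) ↦ X · A + Y · B + Z · C` as a linear map. -/
def frobLinear₃ (X : Matrix (Fin n) (Fin n) ℝ) (Y : Matrix (Fin n) (Fin k) ℝ)
    (Z : Matrix (Fin n) (Fin n) ℝ) : Triple n k →ₗ[ℝ] ℝ where
  toFun p := frob X p.1 + frob Y p.2.1 + frob Z p.2.2
  map_add' p q := by simp [frob, Matrix.mul_add]; ring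
  map_smul' s p := by simp [frob]; ring

/-- The pairing of a triple of measures with a continuous field of triples. -/
def pairing₃ (G : MatrixMeasure X n n) (q : MatrixMeasure X n k) (R : MatrixMeasure X n n)
    (ξ : C(X, Triple n k)) : ℝ :=
  pairing G (fun x => (ξ x).1) + pairing q (fun x => (ξ x).2.1) + pairing R (fun x => (ξ x).2.2)

lemma pairing₃_eq_integral (G : MatrixMeasure X n n) (q : MatrixMeasure X n k)
    (R : MatrixMeasure X n n) (ξ : C(X, Triple n k)) {lam : Measure X}
    (h : lam = entryVariation G + entryVariation q + entryVariation R) :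
    Integrable (fun x => frob (density G lam x) (ξ x).1 + frob (density q lam x) (ξ x).2.1
      + frob (density R lam x) (ξ x).2.2) lam ∧
    pairing₃ G q R ξ = ∫ x, frob (density G lam x) (ξ x).1 + frob (density q lam x) (ξ x).2.1
      + frob (density R lam x) (ξ x).2.2 ∂lam := by
  have : IsFiniteMeasure lam := by rw [h]; infer_instance
  have c1 : Continuous fun x => (ξ x).1 := ξ.continuous.fst
  have c2 : Continuous fun x => (ξ x).2.1 := ξ.continuous.snd.fst
  have c3 : Continuous fun x => (ξ x).2.2 := ξ.continuous.snd.snd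
  have i1 := integrable_frob_density G lam c1
  have i2 := integrable_frob_density q lam c2
  have i3 := integrable_frob_density R lam c3
  refine ⟨(i1.add i2).add i3, ?_⟩
  rw [pairing₃,
    pairing_eq_integral_frob G (lam := lam) _ c1, pairing_eq_integral_frob q (lam := lam) _ c2,
    pairing_eq_integral_frob R (lam := lam) _ c3]
  · exact ((integral_add (i1.add i2) i3).trans (congrArg (· + _) (integral_add i1 i2))).symm
  · rw [h]; exact Measure.le_add_left le_rfl
  · rw [h, add_right_comm]; exact Measure.le_add_left le_rfl
  · rw [h, add_assoc]; exact Measure.le_add_right le_rfl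

/-- At each point ξ x is a competitor in the supremum defining J_Λ. -/
lemma ofReal_pairing₃_le_action {Λ₁ : Matrix (Fin k) (Fin k) ℝ} {Λ₂ : Matrix (Fin n) (Fin n) ℝ}
    (G : MatrixMeasure X n n) (q : MatrixMeasure X n k)
    (R : MatrixMeasure X n n) (ξ : C(X, Triple n k)) (hξ : ∀ x, ξ x ∈ setO Λ₁ Λ₂) :
    ENNReal.ofReal (pairing₃ G q R ξ) ≤ action Λ₁ Λ₂ G q R := by
  obtain ⟨hi, h⟩ := pairing₃_eq_integral G q R ξ rfl
  rw [h]
  refine (ofReal_integral_le_lintegral hi).trans (lintegral_mono fun x => ?_)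
  exact le_iSup₂ (f := fun (p : Triple n k) (_ : p ∈ setO Λ₁ Λ₂) => ENNReal.ofReal
    (frob (density G _ x) p.1 + frob (density q _ x) p.2.1 + frob (density R _ x) p.2.2))
    (ξ x) (hξ x)

end Pairing

/-! ### Representing measures and the bound on their action -/

section Duality

variable {X : Type*} [MeasurableSpace X] [MetricSpace X] [CompactSpace X] [BorelSpace X] {n k : ℕ}

instance {m l : ℕ} : SecondCountableTopology (Matrix (Fin m) (Fin l) ℝ) :=
  inferInstanceAs (SecondCountableTopology (Fin m → Fin l → ℝ))

/-- Converse of `ofReal_pairing₃_le_action`: the action integrates a supremum of linear forms over a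
convex set, so continuous fields suffice to test it. -/
lemma action_le_of_forall_pairing₃_le {Λ₁ : Matrix (Fin k) (Fin k) ℝ}
    {Λ₂ : Matrix (Fin n) (Fin n) ℝ} (h₁ : Λ₁.IsSymm) (h₂ : Λ₂.IsSymm)
    (G : MatrixMeasure X n n) (q : MatrixMeasure X n k) (R : MatrixMeasure X n n) (S : ℝ)
    (h : ∀ ξ : C(X, Triple n k), (∀ x, ξ x ∈ setO Λ₁ Λ₂) → pairing₃ G q R ξ ≤ S) :
    action Λ₁ Λ₂ G q R ≤ ENNReal.ofReal S := by
  refine lintegral_iSup_le_of_forall_continuous (E := Triple n k) (O := setO Λ₁ Λ₂)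
    (entryVariation G + entryVariation q + entryVariation R)
    (convex_setO h₁ h₂) (zero_mem_setO Λ₁ Λ₂)
    (fun x => frobLinear₃ (density G (entryVariation G + entryVariation q + entryVariation R) x)
      (density q (entryVariation G + entryVariation q + entryVariation R) x)
      (density R (entryVariation G + entryVariation q + entryVariation R) x))
    (fun x => ?_) (fun p => ?_) (fun p => ?_) S fun ξ hξ => ?_
  · exact (((continuous_frob _).comp continuous_fst).add
      ((continuous_frob _).comp continuous_snd.fst)).add ((continuous_frob _).comp continuous_snd.snd)
  · exact ((measurable_frob_density _ _ _).add (measurable_frob_density _ _ _)).add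
      (measurable_frob_density _ _ _)
  · exact ((integrable_frob_density_const _ _ _).add (integrable_frob_density_const _ _ _)).add
      (integrable_frob_density_const _ _ _)
  · exact (pairing₃_eq_integral G q R ξ rfl).2 ▸ h ξ hξ

lemma dotProduct_single_mulVec (i j : Fin n) (c : ℝ) (v : Fin n → ℝ) :
    v ⬝ᵥ Matrix.single i j c *ᵥ v = v i * (c * v j) := by
  simp [Matrix.single_mulVec, dotProduct, Function.update_apply]

/-- A functional on continuous fields of triples that is bounded above on the fields with values in
the relaxed set is represented by matrix-valued measures, the first of which is symmetric. -/
lemma exists_measures_of_le (Λ₁ : Matrix (Fin k) (Fin k) ℝ) (Λ₂ : Matrix (Fin n) (Fin n) ℝ)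
    (L : C(X, Triple n k) →ₗ[ℝ] ℝ) (S : ℝ)
    (hL : ∀ ξ : C(X, Triple n k), (∀ x, ξ x ∈ relaxedO Λ₁ Λ₂) → L ξ ≤ S) :
    ∃ (G : MatrixMeasure X n n) (q : MatrixMeasure X n k) (R : MatrixMeasure X n n),
      G.IsSymm ∧ ∀ ξ, L ξ = pairing₃ G q R ξ := by
  obtain ⟨lam, hlam, h⟩ := exists_densities (fun s hs => smul_neg_one_mem_relaxedO Λ₁ Λ₂ hs)
    (exists_add_smul_neg_one_mem_relaxedO Λ₁ Λ₂) L S hL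
  choose u hui hu using h
  let eA : Fin n → Fin n → Triple n k := fun i j => (Matrix.single i j 1, 0, 0)
  let eB : Fin n → Fin k → Triple n k := fun i j => (0, Matrix.single i j 1, 0)
  let eC : Fin n → Fin n → Triple n k := fun i j => (0, 0, Matrix.single i j 1)
  have hanti : ∀ i j (φ : C(X, ℝ)), L (fieldOf (eA i j) φ) = L (fieldOf (eA j i) φ) := by
    -- The matrix E_ij - E_ji has zero quadratic form, so every multiple of this field is admissible
    -- and L cannot be positive on it; exchanging i and j gives the other inequality.
    have hle : ∀ i j (φ : C(X, ℝ)), L (fieldOf (eA i j) φ) - L (fieldOf (eA j i) φ) ≤ 0 := by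
      intro i j φ
      by_contra hcon
      push Not at hcon
      have := hL (((|S| + 1) / (L (fieldOf (eA i j) φ) - L (fieldOf (eA j i) φ))) •
        (fieldOf (eA i j) φ - fieldOf (eA j i) φ)) fun x v => by
          simp [eA, Matrix.sub_mulVec, Matrix.smul_mulVec, dotProduct_sub, dotProduct_smul,
            dotProduct_single_mulVec]
          exact le_of_eq (mul_eq_zero_of_right _ (by ring))
      rw [map_smul, map_sub, smul_eq_mul, div_mul_cancel₀ _ hcon.ne'] at this
      linarith [le_abs_self S]
    intro i j φ
    linarith [hle i j φ, hle j i φ]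
  -- Averaging the densities of the (i, j) and (j, i) directions makes G exactly symmetric; by
  -- `hanti` it represents the same functional.
  refine ⟨fun i j => lam.withDensityᵥ fun x => (u (eA i j) x + u (eA j i) x) / 2,
    fun i j => lam.withDensityᵥ (u (eB i j)), fun i j => lam.withDensityᵥ (u (eC i j)), ?_,
    fun ξ => ?_⟩
  · refine Matrix.IsSymm.ext fun i j => ?_
    change lam.withDensityᵥ _ = lam.withDensityᵥ _
    congr 1
    funext x
    rw [add_comm]
  · have c1 : ∀ i j, Continuous fun x => (ξ x).1 i j := fun i j => ξ.continuous.fst.matrix_elem i j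
    have c2 : ∀ i j, Continuous fun x => (ξ x).2.1 i j :=
      fun i j => ξ.continuous.snd.fst.matrix_elem i j
    have c3 : ∀ i j, Continuous fun x => (ξ x).2.2 i j :=
      fun i j => ξ.continuous.snd.snd.matrix_elem i j
    have hdec : ξ = ∑ i, ∑ j, fieldOf (eA i j) ⟨_, c1 i j⟩ + ∑ i, ∑ j, fieldOf (eB i j) ⟨_, c2 i j⟩
        + ∑ i, ∑ j, fieldOf (eC i j) ⟨_, c3 i j⟩ := by
      ext x i j
      · simp [eA, eB, eC, Prod.fst_sum, ← Matrix.matrix_eq_sum_single]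
      · simp [eA, eB, eC, Prod.fst_sum, Prod.snd_sum, Matrix.sum_apply, Matrix.single_apply,
          ite_and]
      · simp [eA, eB, eC, Prod.snd_sum, Matrix.sum_apply, Matrix.single_apply, ite_and]
    conv_lhs => rw [hdec]
    simp only [map_add, map_sum, pairing₃, pairing]
    congr 1
    · congr 1
      · refine Finset.sum_congr rfl fun i _ => Finset.sum_congr rfl fun j _ => ?_
        rw [integral_withDensityᵥ_eq (u := fun x => (u (eA i j) x + u (eA j i) x) / 2)
          (((hui _).add (hui _)).div_const 2) (c1 i j)]
        have h1 := hu (eA i j) ⟨_, c1 i j⟩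
        have h2 := hu (eA j i) ⟨_, c1 i j⟩
        rw [← hanti] at h2
        simp only [ContinuousMap.coe_mk] at h1 h2
        have h3 : ∀ x, (ξ x).1 i j * ((u (eA i j) x + u (eA j i) x) / 2)
            = (1 / 2) * ((ξ x).1 i j * u (eA i j) x + (ξ x).1 i j * u (eA j i) x) :=
          fun x => by ring
        simp only [h3]
        rw [integral_const_mul, integral_add (integrable_continuous_mul (hui _) (c1 i j))
          (integrable_continuous_mul (hui _) (c1 i j)), ← h1, ← h2]
        ring
      · refine Finset.sum_congr rfl fun i _ => Finset.sum_congr rfl fun j _ => ?_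
        rw [integral_withDensityᵥ_eq (hui _) (c2 i j), hu]
        rfl
    · refine Finset.sum_congr rfl fun i _ => Finset.sum_congr rfl fun j _ => ?_
      rw [integral_withDensityᵥ_eq (hui _) (c3 i j), hu]
      rfl

/-- Representation on fields with values in `O_Λ`, from a bound on fields with values in the
interior of the relaxed set. -/
lemma exists_measures_action_le {Λ₁ : Matrix (Fin k) (Fin k) ℝ}
    {Λ₂ : Matrix (Fin n) (Fin n) ℝ} (h₁ : Λ₁.IsSymm) (h₂ : Λ₂.IsSymm)
    {P : Type*} [AddCommGroup P] [Module ℝ P] (T : P →ₗ[ℝ] C(X, Triple n k))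
    (b : P →ₗ[ℝ] ℝ) (S : ℝ)
    (hT : ∀ φ x, (T φ x).1.IsSymm)
    (hb : ∀ φ, (∀ x, T φ x ∈ setO Λ₁ Λ₂) → b φ ≤ S)
    (hS : ∃ φ, ∀ x, T φ x ∈ interior (relaxedO Λ₁ Λ₂)) :
    ∃ (G : MatrixMeasure X n n) (q : MatrixMeasure X n k) (R : MatrixMeasure X n n),
      G.IsSymm ∧ (∀ φ, pairing₃ G q R (T φ) = b φ) ∧ action Λ₁ Λ₂ G q R ≤ ENNReal.ofReal S := by
  have hconv := convex_relaxedO h₁ h₂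
  obtain ⟨φ₀, hφ₀⟩ := hS
  obtain ⟨L, hLT, hL⟩ := exists_extension_le
    (K := {ξ : C(X, Triple n k) | Set.MapsTo ξ Set.univ (interior (relaxedO Λ₁ Λ₂))})
    (fun ξ hξ η hη a b ha hb hab x _ => hconv.interior (hξ trivial) (hη trivial) ha hb hab)
    -- Compactness of the space makes the interior-valued fields an open set.
    (ContinuousMap.isOpen_setOfPred_mapsTo isCompact_univ isOpen_interior) T b S
    (fun φ hφ => hb φ fun x => (mem_setO_iff h₁ h₂).2
      ⟨hT φ x, interior_subset (hφ (Set.mem_univ x))⟩)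
    ⟨φ₀, fun x _ => hφ₀ x⟩
  -- Moving an admissible field slightly towards the Slater field makes it interior-valued.
  have hLr : ∀ ξ : C(X, Triple n k), (∀ x, ξ x ∈ relaxedO Λ₁ Λ₂) → L ξ ≤ S := fun ξ hξ =>
    le_of_forall_combo_le L.toLinearMap ξ (T φ₀) fun s hs hs1 => hL _ fun x _ =>
      hconv.combo_self_interior_mem_interior (hξ x) (hφ₀ x) (by linarith) hs (by ring)
  obtain ⟨G, q, R, hG, hrep⟩ := exists_measures_of_le Λ₁ Λ₂ L.toLinearMap S hLr
  refine ⟨G, q, R, hG, fun φ => (hrep _).symm.trans (hLT φ),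
    action_le_of_forall_pairing₃_le h₁ h₂ G q R S fun ξ hξ => ?_⟩
  rw [← hrep]
  exact hLr ξ fun x => ((mem_setO_iff h₁ h₂).1 (hξ x)).2

end Duality

/-! ### The vector space of test fields and its derivatives -/

section TestFields

variable {d n k : ℕ}

/-- The `C¹` fields of symmetric matrices as a vector space. -/
def testFields (d n : ℕ) :
    Submodule ℝ (ℝ → EuclideanSpace ℝ (Fin d) → Matrix (Fin n) (Fin n) ℝ) where
  carrier := {Φ | IsTestField Φ}
  zero_mem' := ⟨fun _ _ => Matrix.isSymm_zero, fun _ _ => contDiff_const⟩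
  add_mem' hΦ hΨ := ⟨fun t x => (hΦ.1 t x).add (hΨ.1 t x), fun i j => (hΦ.2 i j).add (hΨ.2 i j)⟩
  smul_mem' c _ hΦ := ⟨fun t x => (hΦ.1 t x).smul c, fun i j => contDiff_const.mul (hΦ.2 i j)⟩

/-- The entry `(i, j)` as a function on space-time. -/
def entry (Φ : ℝ → EuclideanSpace ℝ (Fin d) → Matrix (Fin n) (Fin n) ℝ) (i j : Fin n)
    (p : ℝ × EuclideanSpace ℝ (Fin d)) : ℝ := Φ p.1 p.2 i j

lemma differentiable_entry (Φ : testFields d n) (i j : Fin n) :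
    Differentiable ℝ (entry Φ.1 i j) :=
  (Φ.2.2 i j).differentiable one_ne_zero

/-- As a directional derivative of a jointly C¹ function, the time derivative is jointly continuous
and linear in Φ; `partialDeriv_apply` does the same in space. -/
lemma timeDeriv_apply (Φ : testFields d n) (t : ℝ) (x : EuclideanSpace ℝ (Fin d))
    (i j : Fin n) :
    timeDeriv Φ.1 t x i j = fderiv ℝ (entry Φ.1 i j) (t, x) (1, 0) := by
  have h := (differentiable_entry Φ i j (t, x)).hasFDerivAt.comp_hasDerivAt t
    ((hasDerivAt_id t).prodMk (hasDerivAt_const t x))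
  exact h.deriv

lemma partialDeriv_apply (Φ : testFields d n) (l : Fin d) (t : ℝ)
    (x : EuclideanSpace ℝ (Fin d))
    (i j : Fin n) :
    partialDeriv l (Φ.1 t) x i j
      = fderiv ℝ (entry Φ.1 i j) (t, x) (0, EuclideanSpace.single l 1) := by
  have h := (differentiable_entry Φ i j (t, x)).hasFDerivAt.comp x
    ((hasFDerivAt_const t x).prodMk (hasFDerivAt_id x))
  have h' : fderiv ℝ (fun y => Φ.1 t y i j) x = _ := h.fderiv
  simp only [partialDeriv, Matrix.of_apply, h']
  simp

lemma continuous_fderiv_entry (Φ : testFields d n) (i j : Fin n)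
    (v : ℝ × EuclideanSpace ℝ (Fin d)) :
    Continuous fun p => fderiv ℝ (entry Φ.1 i j) p v :=
  ((Φ.2.2 i j).continuous_fderiv one_ne_zero).clm_apply continuous_const

lemma continuous_testField (Φ : testFields d n) :
    Continuous fun p : ℝ × EuclideanSpace ℝ (Fin d) => Φ.1 p.1 p.2 :=
  continuous_matrix fun i j => (Φ.2.2 i j).continuous

lemma continuous_timeDeriv (Φ : testFields d n) :
    Continuous fun p : ℝ × EuclideanSpace ℝ (Fin d) => timeDeriv Φ.1 p.1 p.2 :=
  continuous_matrix fun i j => by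
    simp only [timeDeriv_apply]
    exact continuous_fderiv_entry Φ i j _

lemma continuous_partialDeriv (Φ : testFields d n) (l : Fin d) :
    Continuous fun p : ℝ × EuclideanSpace ℝ (Fin d) => partialDeriv l (Φ.1 p.1) p.2 :=
  continuous_matrix fun i j => by
    simp only [partialDeriv_apply]
    exact continuous_fderiv_entry Φ i j _

lemma continuous_matrix_linearMap {m l m' l' : ℕ}
    (f : Matrix (Fin m) (Fin l) ℝ →ₗ[ℝ] Matrix (Fin m') (Fin l') ℝ) : Continuous f := by
  have : T2Space (Matrix (Fin m) (Fin l) ℝ) := inferInstanceAs (T2Space (Fin m → Fin l → ℝ))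
  exact f.continuous_of_finiteDimensional

lemma continuous_diffOp (D : DiffOp d n k) (Φ : testFields d n) :
    Continuous fun p : ℝ × EuclideanSpace ℝ (Fin d) => D.apply (Φ.1 p.1) p.2 :=
  ((continuous_matrix_linearMap _).comp (continuous_testField Φ)).add
    (continuous_finsetSum _ fun l _ =>
      (continuous_matrix_linearMap _).comp (continuous_partialDeriv Φ l))

lemma fderiv_entry_add (Φ Ψ : testFields d n) (i j : Fin n) (p : ℝ × EuclideanSpace ℝ (Fin d)) :
    fderiv ℝ (entry (Φ + Ψ).1 i j) p
      = fderiv ℝ (entry Φ.1 i j) p + fderiv ℝ (entry Ψ.1 i j) p :=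
  fderiv_add (differentiable_entry Φ i j p) (differentiable_entry Ψ i j p)

lemma fderiv_entry_smul (c : ℝ) (Φ : testFields d n) (i j : Fin n)
    (p : ℝ × EuclideanSpace ℝ (Fin d)) :
    fderiv ℝ (entry (c • Φ).1 i j) p = c • fderiv ℝ (entry Φ.1 i j) p :=
  fderiv_const_smul (differentiable_entry Φ i j p) c

lemma timeDeriv_add (Φ Ψ : testFields d n) (t : ℝ) (x : EuclideanSpace ℝ (Fin d)) :
    timeDeriv (Φ + Ψ).1 t x = timeDeriv Φ.1 t x + timeDeriv Ψ.1 t x := by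
  ext i j
  rw [Matrix.add_apply, timeDeriv_apply, timeDeriv_apply, timeDeriv_apply, fderiv_entry_add]
  rfl

lemma timeDeriv_smul (c : ℝ) (Φ : testFields d n) (t : ℝ) (x : EuclideanSpace ℝ (Fin d)) :
    timeDeriv (c • Φ).1 t x = c • timeDeriv Φ.1 t x := by
  ext i j
  rw [Matrix.smul_apply, timeDeriv_apply, timeDeriv_apply, fderiv_entry_smul]
  rfl

lemma partialDeriv_add (Φ Ψ : testFields d n) (l : Fin d) (t : ℝ)
    (x : EuclideanSpace ℝ (Fin d)) :
    partialDeriv l ((Φ + Ψ).1 t) x = partialDeriv l (Φ.1 t) x + partialDeriv l (Ψ.1 t) x := by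
  ext i j
  rw [Matrix.add_apply, partialDeriv_apply, partialDeriv_apply, partialDeriv_apply,
    fderiv_entry_add]
  rfl

lemma partialDeriv_smul (c : ℝ) (Φ : testFields d n) (l : Fin d) (t : ℝ)
    (x : EuclideanSpace ℝ (Fin d)) :
    partialDeriv l ((c • Φ).1 t) x = c • partialDeriv l (Φ.1 t) x := by
  ext i j
  rw [Matrix.smul_apply, partialDeriv_apply, partialDeriv_apply, fderiv_entry_smul]
  rfl

lemma diffOp_add (D : DiffOp d n k) (Φ Ψ : testFields d n) (t : ℝ) (x : EuclideanSpace ℝ (Fin d)) :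
    D.apply ((Φ + Ψ).1 t) x = D.apply (Φ.1 t) x + D.apply (Ψ.1 t) x := by
  simp only [DiffOp.apply, partialDeriv_add, map_add, Finset.sum_add_distrib]
  rw [show (Φ + Ψ).1 t x = Φ.1 t x + Ψ.1 t x from rfl, map_add]
  abel

lemma diffOp_smul (D : DiffOp d n k) (c : ℝ) (Φ : testFields d n) (t : ℝ)
    (x : EuclideanSpace ℝ (Fin d)) :
    D.apply ((c • Φ).1 t) x = c • D.apply (Φ.1 t) x := by
  simp only [DiffOp.apply, partialDeriv_smul, map_smul, smul_add, Finset.smul_sum]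
  rw [show (c • Φ).1 t x = c • Φ.1 t x from rfl, map_smul]

lemma timeDeriv_isSymm (Φ : testFields d n) (t : ℝ) (x : EuclideanSpace ℝ (Fin d)) :
    (timeDeriv Φ.1 t x).IsSymm :=
  Matrix.IsSymm.ext fun i j => by
    simp only [timeDeriv, Matrix.of_apply]
    congr 1
    funext s
    exact (Φ.2.1 s x).apply i j

/-- On constant fields only the zeroth-order coefficient acts, so D*(I) = 0 says that it annihilates
I. -/
lemma diffOp_const (D : DiffOp d n k) (hD : ∀ x, D.apply (fun _ => 1) x = 0) (c : ℝ)
    (x : EuclideanSpace ℝ (Fin d)) :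
    D.apply (fun _ => c • 1) x = 0 := by
  have hp : ∀ (M : Matrix (Fin n) (Fin n) ℝ) l (x : EuclideanSpace ℝ (Fin d)),
      partialDeriv l (fun _ => M) x = 0 := by
    intro M l x
    ext i j
    simp [partialDeriv]
  have h := hD x
  simp only [DiffOp.apply, hp, map_zero, Finset.sum_const_zero, add_zero] at h ⊢
  rw [map_smul, h, smul_zero]

end TestFields

/-! ### Kantorovich duality and its consequences -/

section Dynamic

variable {d n k : ℕ} {Ω : Set (EuclideanSpace ℝ (Fin d))}

/-- The field `(∂ₜ Φ, D* Φ, Φ)` on `Q = [0, 1] × Ω`. -/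
def jet (D : DiffOp d n k) (Ω : Set (EuclideanSpace ℝ (Fin d))) :
    testFields d n →ₗ[ℝ] C(unitInterval × Ω, Triple n k) where
  toFun Φ := ⟨fun z => (timeDeriv Φ.1 z.1 z.2, D.apply (Φ.1 z.1) z.2, Φ.1 z.1 z.2), by
    have h : Continuous fun z : unitInterval × Ω => ((z.1 : ℝ), (z.2 : EuclideanSpace ℝ (Fin d))) :=
      by fun_prop
    exact ((continuous_timeDeriv Φ).comp h).prodMk
      (((continuous_diffOp D Φ).comp h).prodMk ((continuous_testField Φ).comp h))⟩
  map_add' Φ Ψ := by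
    ext1 z
    exact Prod.ext (timeDeriv_add Φ Ψ _ _) (Prod.ext (diffOp_add D Φ Ψ _ _) rfl)
  map_smul' c Φ := by
    ext1 z
    exact Prod.ext (timeDeriv_smul c Φ _ _) (Prod.ext (diffOp_smul D c Φ _ _) rfl)

lemma jet_apply (D : DiffOp d n k) (Φ : testFields d n) (z : unitInterval × Ω) :
    jet D Ω Φ z = (timeDeriv Φ.1 z.1 z.2, D.apply (Φ.1 z.1) z.2, Φ.1 z.1 z.2) := rfl

lemma continuous_slice (Φ : testFields d n) (t : ℝ) : Continuous fun x : Ω => Φ.1 t x :=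
  (continuous_testField Φ).comp (by fun_prop : Continuous fun x : Ω =>
    (t, (x : EuclideanSpace ℝ (Fin d))))

/-- `⟨G₁, Φ(1)⟩ - ⟨G₀, Φ(0)⟩` as a linear functional of the test field. -/
def boundaryPairing [CompactSpace Ω] (G₀ G₁ : MatrixMeasure Ω n n) : testFields d n →ₗ[ℝ] ℝ where
  toFun Φ := pairing G₁ (fun x => Φ.1 1 x) - pairing G₀ (fun x => Φ.1 0 x)
  map_add' Φ Ψ := by
    have h : ∀ (G : MatrixMeasure Ω n n) t, pairing G (fun x => (Φ + Ψ).1 t x)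
        = pairing G (fun x => Φ.1 t x) + pairing G (fun x => Ψ.1 t x) := fun G t =>
      pairing_add G (continuous_slice Φ t) (continuous_slice Ψ t)
    rw [h, h]
    ring
  map_smul' c Φ := by
    have h : ∀ (G : MatrixMeasure Ω n n) t, pairing G (fun x => (c • Φ).1 t x)
        = c * pairing G (fun x => Φ.1 t x) := fun G t => pairing_smul c G _
    rw [h, h, RingHom.id_apply, smul_eq_mul]
    ring

lemma boundaryPairing_apply [CompactSpace Ω] (G₀ G₁ : MatrixMeasure Ω n n) (Φ : testFields d n) :
    boundaryPairing G₀ G₁ Φ = pairing G₁ (fun x => Φ.1 1 x) - pairing G₀ (fun x => Φ.1 0 x) := rfl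

lemma continuityEq_iff [CompactSpace Ω] (D : DiffOp d n k) (G₀ G₁ : MatrixMeasure Ω n n)
    (G : MatrixMeasure (unitInterval × Ω) n n) (q : MatrixMeasure (unitInterval × Ω) n k)
    (R : MatrixMeasure (unitInterval × Ω) n n) :
    ContinuityEq D G₀ G₁ G q R ↔
      G.IsSymm ∧ ∀ Φ, pairing₃ G q R (jet D Ω Φ) = boundaryPairing G₀ G₁ Φ :=
  and_congr_right fun _ => ⟨fun h Φ => h Φ.1 Φ.2, fun h Φ hΦ => h ⟨Φ, hΦ⟩⟩

/-- The test field `-c t I`. -/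
def linearField (d n : ℕ) (c : ℝ) : testFields d n :=
  ⟨fun t _ => (-(c * t)) • 1, fun _ _ => Matrix.isSymm_one.smul _, fun i j => by
    simp only [Matrix.smul_apply, smul_eq_mul]
    fun_prop⟩

lemma jet_linearField (D : DiffOp d n k) (hD : ∀ x, D.apply (fun _ => 1) x = 0) (c : ℝ)
    (z : unitInterval × Ω) :
    jet D Ω (linearField d n c) z = (-(c • 1), 0, (-(c * (z.1 : ℝ))) • 1) := by
  rw [jet_apply]
  refine Prod.ext ?_ (Prod.ext (diffOp_const D hD _ _) rfl)
  ext i j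
  have h : HasDerivAt (fun s : ℝ => (-(c * s)) * (1 : Matrix (Fin n) (Fin n) ℝ) i j)
      ((-(c * 1)) * (1 : Matrix (Fin n) (Fin n) ℝ) i j) (z.1 : ℝ) :=
    (((hasDerivAt_id _).const_mul c).neg).mul_const _
  simpa only [timeDeriv, linearField, Matrix.of_apply, Matrix.smul_apply, Matrix.neg_apply,
    smul_eq_mul, mul_one, neg_mul] using h.deriv

lemma exists_jet_mem_interior (Λ₁ : Matrix (Fin k) (Fin k) ℝ) (Λ₂ : Matrix (Fin n) (Fin n) ℝ)
    (D : DiffOp d n k) (hD : ∀ x, D.apply (fun _ => 1) x = 0) :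
    ∃ Φ, ∀ z, jet D Ω Φ z ∈ interior (relaxedO Λ₁ Λ₂) := by
  have hM := entrySum_nonneg (Λ₂ ^ 2)
  set M := entrySum (Λ₂ ^ 2) with hMdef
  have hε : 0 < (1 + M)⁻¹ := by positivity
  -- The jet of -ctI is (-cI, 0, -ctI), and the interior criterion with ε = c asks for ½c²t²M < c.
  -- As t ≤ 1, the choice c = 1/(1 + M) suffices.
  refine ⟨linearField d n (1 + M)⁻¹, fun z => ?_⟩
  rw [jet_linearField D hD]
  refine mem_interior_relaxedO (ε := (1 + M)⁻¹) ?_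
  have hz0 : 0 ≤ (z.1 : ℝ) := z.1.2.1
  have hz1 : (z.1 : ℝ) ≤ 1 := z.1.2.2
  have h0 : entrySum (0 : Matrix (Fin n) (Fin n) ℝ) = 0 := by simp [entrySum]
  simp only [neg_add_cancel, Matrix.transpose_smul, Matrix.transpose_one, Matrix.smul_mul,
    Matrix.mul_smul, Matrix.one_mul, Matrix.mul_one, Matrix.zero_mul, entrySum_smul, h0,
    ← hMdef]
  rw [← mul_assoc |(-((1 + M)⁻¹ * (z.1 : ℝ)))|, abs_mul_abs_self]
  have h1 : (1 + M)⁻¹ * M < 1 := by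
    rw [inv_mul_lt_iff₀ (by positivity)]; linarith
  have h2 : (z.1 : ℝ) * z.1 ≤ 1 := by nlinarith
  have h3 : (1 + M)⁻¹ * ((1 + M)⁻¹ * M) ≤ (1 + M)⁻¹ := mul_le_of_le_one_right hε.le h1.le
  have h4 : (1 + M)⁻¹ * ((1 + M)⁻¹ * M) * ((z.1 : ℝ) * z.1) ≤ (1 + M)⁻¹ :=
    (mul_le_of_le_one_right (by positivity) h2).trans h3
  nlinarith

/-- Kantorovich duality for the squared weighted Wasserstein-Bures distance. -/
theorem WBsq_eq_iSup [CompactSpace Ω] {Λ₁ : Matrix (Fin k) (Fin k) ℝ}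
    {Λ₂ : Matrix (Fin n) (Fin n) ℝ} (h₁ : Λ₁.IsSymm) (h₂ : Λ₂.IsSymm)
    (D : DiffOp d n k) (hD : ∀ x, D.apply (fun _ => 1) x = 0) (G₀ G₁ : MatrixMeasure Ω n n) :
    WBsq Λ₁ Λ₂ D G₀ G₁ = ⨆ Φ : {Φ : testFields d n // ∀ z, jet D Ω Φ z ∈ setO Λ₁ Λ₂},
      ENNReal.ofReal (boundaryPairing G₀ G₁ Φ) := by
  refine le_antisymm ?_ (iSup_le fun Φ => le_iInf fun G => le_iInf fun q => le_iInf fun R =>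
    le_iInf fun h => ?_)
  · set S := ⨆ Φ : {Φ : testFields d n // ∀ z, jet D Ω Φ z ∈ setO Λ₁ Λ₂},
      ENNReal.ofReal (boundaryPairing G₀ G₁ Φ) with hSdef
    rcases eq_or_ne S ⊤ with hS | hS
    · rw [hS]; exact le_top
    obtain ⟨G, q, R, hG, hT, ha⟩ := exists_measures_action_le h₁ h₂ (jet D Ω)
      (boundaryPairing G₀ G₁) S.toReal (fun Φ z => timeDeriv_isSymm Φ _ _)
      (fun Φ hΦ => (ENNReal.ofReal_le_iff_le_toReal hS).1 (le_iSup
        (fun Φ : {Φ : testFields d n // ∀ z, jet D Ω Φ z ∈ setO Λ₁ Λ₂} =>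
          ENNReal.ofReal (boundaryPairing G₀ G₁ Φ)) ⟨Φ, hΦ⟩))
      (exists_jet_mem_interior Λ₁ Λ₂ D hD)
    rw [ENNReal.ofReal_toReal hS] at ha
    refine le_trans ?_ ha
    refine (iInf_le _ G).trans ?_
    refine (iInf_le _ q).trans ?_
    refine (iInf_le _ R).trans ?_
    exact iInf_le _ ((continuityEq_iff D G₀ G₁ G q R).2 ⟨hG, hT⟩)
  · rw [← ((continuityEq_iff D G₀ G₁ G q R).1 h).2]
    exact ofReal_pairing₃_le_action G q R _ Φ.2

lemma boundaryPairing_smul [CompactSpace Ω] (α : ℝ) (G₀ G₁ : MatrixMeasure Ω n n)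
    (Φ : testFields d n) :
    boundaryPairing (α • G₀) (α • G₁) Φ = α * boundaryPairing G₀ G₁ Φ := by
  simp only [boundaryPairing_apply, pairing_smul_measure]
  ring

lemma boundaryPairing_add [CompactSpace Ω] (G₀ G₁ H₀ H₁ : MatrixMeasure Ω n n)
    (Φ : testFields d n) :
    boundaryPairing (G₀ + H₀) (G₁ + H₁) Φ = boundaryPairing G₀ G₁ Φ + boundaryPairing H₀ H₁ Φ := by
  simp only [boundaryPairing_apply]
  rw [pairing_add_measure _ _ (continuous_slice Φ 1), pairing_add_measure _ _ (continuous_slice Φ 0)]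
  ring

lemma tendsto_boundaryPairing [CompactSpace Ω] {ι : Type*} {l : Filter ι}
    {H₀ H₁ : ι → MatrixMeasure Ω n n} {G₀ G₁ : MatrixMeasure Ω n n}
    (h₀ : WeakStarTendsto H₀ l G₀) (h₁ : WeakStarTendsto H₁ l G₁) (Φ : testFields d n) :
    Tendsto (fun i => boundaryPairing (H₀ i) (H₁ i) Φ) l (𝓝 (boundaryPairing G₀ G₁ Φ)) :=
  (h₁ ⟨_, continuous_slice Φ 1⟩).sub (h₀ ⟨_, continuous_slice Φ 0⟩)

lemma WB_eq_iSup [CompactSpace Ω] {Λ₁ : Matrix (Fin k) (Fin k) ℝ}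
    {Λ₂ : Matrix (Fin n) (Fin n) ℝ} (h₁ : Λ₁.IsSymm) (h₂ : Λ₂.IsSymm)
    (D : DiffOp d n k) (hD : ∀ x, D.apply (fun _ => 1) x = 0) (G₀ G₁ : MatrixMeasure Ω n n) :
    WB Λ₁ Λ₂ D G₀ G₁ = ⨆ Φ : {Φ : testFields d n // ∀ z, jet D Ω Φ z ∈ setO Λ₁ Λ₂},
      ENNReal.ofReal (boundaryPairing G₀ G₁ Φ) ^ (1 / 2 : ℝ) := by
  rw [WB, WBsq_eq_iSup h₁ h₂ D hD]
  -- The square root is an order isomorphism of [0, ∞], so it passes inside the supremum.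
  exact (ENNReal.orderIsoRpow (1 / 2) (by norm_num)).map_iSup _

/-- Joint weak-star lower semicontinuity of the weighted Wasserstein-Bures distance. -/
theorem WB_le_liminf [CompactSpace Ω] {Λ₁ : Matrix (Fin k) (Fin k) ℝ}
    {Λ₂ : Matrix (Fin n) (Fin n) ℝ} (h₁ : Λ₁.IsSymm) (h₂ : Λ₂.IsSymm)
    (D : DiffOp d n k) (hD : ∀ x, D.apply (fun _ => 1) x = 0) {ι : Type*} {l : Filter ι}
    {H₀ H₁ : ι → MatrixMeasure Ω n n} {G₀ G₁ : MatrixMeasure Ω n n}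
    (hl₀ : WeakStarTendsto H₀ l G₀) (hl₁ : WeakStarTendsto H₁ l G₁) :
    WB Λ₁ Λ₂ D G₀ G₁ ≤ liminf (fun i => WB Λ₁ Λ₂ D (H₀ i) (H₁ i)) l := by
  -- Along the trivial filter the lower limit is ⊤.
  rcases l.eq_or_neBot with rfl | hne
  · simp
  rw [WB_eq_iSup h₁ h₂ D hD]
  refine iSup_le fun Φ => ?_
  have hb := tendsto_boundaryPairing hl₀ hl₁ Φ.1
  have ht : Tendsto (fun i => ENNReal.ofReal (boundaryPairing (H₀ i) (H₁ i) Φ.1) ^ (1 / 2 : ℝ)) l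
      (𝓝 (ENNReal.ofReal (boundaryPairing G₀ G₁ Φ.1) ^ (1 / 2 : ℝ))) :=
    (ENNReal.tendsto_ofReal hb).ennrpow_const _
  rw [← ht.liminf_eq]
  refine liminf_le_liminf (Eventually.of_forall fun i => ?_)
  simp only [WB_eq_iSup h₁ h₂ D hD]
  exact le_iSup (fun Φ : {Φ : testFields d n // ∀ z, jet D Ω Φ z ∈ setO Λ₁ Λ₂} =>
    ENNReal.ofReal (boundaryPairing (H₀ i) (H₁ i) Φ.1) ^ (1 / 2 : ℝ)) Φ

lemma WBsq_smul [CompactSpace Ω] {Λ₁ : Matrix (Fin k) (Fin k) ℝ}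
    {Λ₂ : Matrix (Fin n) (Fin n) ℝ} (h₁ : Λ₁.IsSymm) (h₂ : Λ₂.IsSymm)
    (D : DiffOp d n k) (hD : ∀ x, D.apply (fun _ => 1) x = 0) {α : ℝ} (hα : 0 ≤ α)
    (G₀ G₁ : MatrixMeasure Ω n n) :
    WBsq Λ₁ Λ₂ D (α • G₀) (α • G₁) = ENNReal.ofReal α * WBsq Λ₁ Λ₂ D G₀ G₁ := by
  simp only [WBsq_eq_iSup h₁ h₂ D hD, ENNReal.mul_iSup, boundaryPairing_smul,
    ENNReal.ofReal_mul hα]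

/-- Each Φ is admissible for both pairs of endpoints, and the supremum of a sum is at most the sum
of the suprema. -/
lemma WBsq_add_le [CompactSpace Ω] {Λ₁ : Matrix (Fin k) (Fin k) ℝ}
    {Λ₂ : Matrix (Fin n) (Fin n) ℝ} (h₁ : Λ₁.IsSymm) (h₂ : Λ₂.IsSymm)
    (D : DiffOp d n k) (hD : ∀ x, D.apply (fun _ => 1) x = 0)
    (G₀ G₁ H₀ H₁ : MatrixMeasure Ω n n) :
    WBsq Λ₁ Λ₂ D (G₀ + H₀) (G₁ + H₁) ≤ WBsq Λ₁ Λ₂ D G₀ G₁ + WBsq Λ₁ Λ₂ D H₀ H₁ := by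
  simp only [WBsq_eq_iSup h₁ h₂ D hD]
  refine iSup_le fun Φ => ?_
  rw [boundaryPairing_add]
  exact ENNReal.ofReal_add_le.trans (add_le_add
    (le_iSup (fun Φ : {Φ : testFields d n // ∀ z, jet D Ω Φ z ∈ setO Λ₁ Λ₂} =>
      ENNReal.ofReal (boundaryPairing G₀ G₁ Φ)) Φ)
    (le_iSup (fun Φ : {Φ : testFields d n // ∀ z, jet D Ω Φ z ∈ setO Λ₁ Λ₂} =>
      ENNReal.ofReal (boundaryPairing H₀ H₁ Φ)) Φ))

end Dynamic

end WassersteinBures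

end

theorem mainTheorem10 (d n k : ℕ)
    (U : Set (EuclideanSpace ℝ (Fin d))) (hUo : IsOpen U) (hUb : Bornology.IsBounded U)
    (hUc : Convex ℝ U)
    (Λ₁ : Matrix (Fin k) (Fin k) ℝ) (hΛ₁ : Λ₁.PosSemidef)
    (Λ₂ : Matrix (Fin n) (Fin n) ℝ) (hΛ₂ : Λ₂.PosDef)
    (D : WassersteinBures.DiffOp d n k) (hD : ∀ x, D.apply (fun _ => 1) x = 0) :
    (∀ (α : ℝ) (G₀ G₁ : WassersteinBures.MatrixMeasure (closure U) n n),
      0 < α → G₀.IsPSD → G₁.IsPSD →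
        WassersteinBures.WBsq Λ₁ Λ₂ D (α • G₀) (α • G₁)
          = ENNReal.ofReal α * WassersteinBures.WBsq Λ₁ Λ₂ D G₀ G₁) ∧
    (∀ G₀ G₁ G₀' G₁' : WassersteinBures.MatrixMeasure (closure U) n n,
      G₀.IsPSD → G₁.IsPSD → G₀'.IsPSD → G₁'.IsPSD →
        WassersteinBures.WBsq Λ₁ Λ₂ D (G₀ + G₀') (G₁ + G₁')
          ≤ WassersteinBures.WBsq Λ₁ Λ₂ D G₀ G₁ + WassersteinBures.WBsq Λ₁ Λ₂ D G₀' G₁') ∧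
    (∀ (ι : Type) (l : Filter ι)
      (H₀ H₁ : ι → WassersteinBures.MatrixMeasure (closure U) n n)
      (G₀ G₁ : WassersteinBures.MatrixMeasure (closure U) n n),
      (∀ i, (H₀ i).IsPSD) → (∀ i, (H₁ i).IsPSD) → G₀.IsPSD → G₁.IsPSD →
      WassersteinBures.WeakStarTendsto H₀ l G₀ → WassersteinBures.WeakStarTendsto H₁ l G₁ →
        WassersteinBures.WB Λ₁ Λ₂ D G₀ G₁
          ≤ liminf (fun i => WassersteinBures.WB Λ₁ Λ₂ D (H₀ i) (H₁ i)) l) := by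
  have hc : CompactSpace (closure U) := isCompact_iff_compactSpace.1 hUb.isCompact_closure
  have h₁ : Λ₁.IsSymm := Matrix.isHermitian_iff_isSymm.1 hΛ₁.isHermitian
  have h₂ : Λ₂.IsSymm := Matrix.isHermitian_iff_isSymm.1 hΛ₂.isHermitian
  exact ⟨fun α G₀ G₁ hα _ _ => WassersteinBures.WBsq_smul h₁ h₂ D hD hα.le G₀ G₁,
    fun G₀ G₁ G₀' G₁' _ _ _ _ => WassersteinBures.WBsq_add_le h₁ h₂ D hD G₀ G₁ G₀' G₁',
    fun ι l H₀ H₁ G₀ G₁ _ _ _ _ hl₀ hl₁ => WassersteinBures.WB_le_liminf h₁ h₂ D hD hl₀ hl₁⟩
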